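/- Let $G$ be a second-countable, locally compact, Hausdorff, étale groupoid (a topological groupoid whose range and source maps $r,s:G\to G^{(0)}$ are local homeomorphisms), with unit space $G^{(0)}=\{\gamma\gamma^{-1}:\gamma\in G\}$. Call $G$ topologically principal if the set of units $u\in G^{(0)}$ with trivial isotropy, $\{\gamma\in G: r(\gamma)=s(\gamma)=u\}=\{u\}$, is dense in $G^{(0)}$. Regard $C_c(G)$ as a $*$-algebra with $(f*g)(\gamma)=\sum_{r(\alpha)=r(\gamma)}f(\alpha)g(\alpha^{-1}\gamma)$ and $f^*(\gamma)=\overline{f(\gamma^{-1})}$, and let $\|f\|_I=\sup_{u\in G^{(0)}}\max\{\sum_{s(\gamma)=u}|f(\gamma)|,\sum_{r(\gamma)=u}|f(\gamma)|\}$. The full $C^*$-algebra $C^*(G)$ is the completion of $C_c(G)$ in the norm $\|f\|=\sup\{\|\pi(f)\|:\pi\text{ an }\|\cdot\|_I\text{-bounded }*\text{-representation of }C_c(G)\text{ on a Hilbert space}\}$. The reduced $C^*$-algebra $C_r^*(G)$ is the completion of $C_c(G)$ in the norm $\|f\|_r=\sup_{u\in G^{(0)}}\|\mathrm{Ind}_u(f)\|$,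 where $\mathrm{Ind}_u$ is the representation of $C_c(G)$ on $\ell^2(\{\gamma: s(\gamma)=u\})$ given by convolution, $(\mathrm{Ind}_u(f)\xi)(\beta)=\sum_{s(\gamma)=u}f(\beta\gamma^{-1})\xi(\gamma)$. Since $G^{(0)}$ is open and closed in $G$, $C_c(G^{(0)})$ is a subalgebra of $C_c(G)$ (extend by zero); its closure in $C^*(G)$ is $C_0(G^{(0)})$. "Ideal" means closed two-sided ideal. 1. If $G$ is topologically principal, then every nonzero ideal $I$ of $C_r^*(G)$ satisfies $I\cap C_c(G^{(0)})\neq\{0\}$. 2. If every nonzero ideal $I$ of $C^*(G)$ satisfies $I\cap C_0(G^{(0)})\neq\{0\}$, then $G$ is topologically principal. -/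

import Mathlib

open scoped ENNReal NNReal CompactlySupported Topology

universe u

noncomputable section

/-- A groupoid presented by its set `G` of morphisms: source and range maps `src`, `rng` (with values
in the identity morphisms), an inversion `inv`, and a composition `a ⋄ b`, which is meaningful (and
subject to the axioms) exactly for the composable pairs, those with `src a = rng b`. The value of
`a ⋄ b` for other pairs is irrelevant. -/
class ArrowGroupoid (G : Type u) where
  src : G → G
  rng : G → G
  inv : G → G
  comp : G → G → G
  rng_src : ∀ a, rng (src a) = src a
  src_rng : ∀ a, src (rng a) = rng a
  src_comp : ∀ a b, src a = rng b → src (comp a b) = src b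
  rng_comp : ∀ a b, src a = rng b → rng (comp a b) = rng a
  comp_assoc : ∀ a b c, src a = rng b → src b = rng c → comp (comp a b) c = comp a (comp b c)
  comp_src : ∀ a, comp a (src a) = a
  rng_comp_self : ∀ a, comp (rng a) a = a
  src_inv : ∀ a, src (inv a) = rng a
  rng_inv : ∀ a, rng (inv a) = src a
  inv_comp : ∀ a, comp (inv a) a = src a
  comp_inv : ∀ a, comp a (inv a) = rng a

namespace ArrowGroupoid

infixl:70 " ⋄ " => ArrowGroupoid.comp

section Algebra

variable {G : Type u} [ArrowGroupoid G]

attribute [simp] rng_src src_rng src_inv rng_inv inv_comp comp_inv comp_src rng_comp_self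

@[simp] theorem src_src (a : G) : src (src a) = src a := by
  rw [← rng_src a, src_rng]

@[simp] theorem rng_rng (a : G) : rng (rng a) = rng a := by
  rw [← src_rng a, rng_src]

theorem inv_comp_cancel_left (a b : G) (h : src a = rng b) : inv a ⋄ (a ⋄ b) = b := by
  rw [← comp_assoc _ _ _ (by simp) h, inv_comp, h, rng_comp_self]

theorem comp_inv_cancel_left (a b : G) (h : rng a = rng b) : a ⋄ (inv a ⋄ b) = b := by
  rw [← comp_assoc _ _ _ (by simp) (by simpa using h), comp_inv, h, rng_comp_self]

theorem comp_inv_cancel_right (a b : G) (h : src a = rng b) : (a ⋄ b) ⋄ inv b = a := by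
  rw [comp_assoc _ _ _ h (by simp), comp_inv, ← h, comp_src]

theorem inv_comp_cancel_right (a b : G) (h : src a = src b) : (a ⋄ inv b) ⋄ b = a := by
  rw [comp_assoc _ _ _ (by simpa using h) (by simp), inv_comp, ← h, comp_src]

theorem comp_left_cancel {a b c : G} (hb : src a = rng b) (hc : src a = rng c)
    (h : a ⋄ b = a ⋄ c) : b = c := by
  rw [← inv_comp_cancel_left a b hb, h, inv_comp_cancel_left a c hc]

@[simp] theorem inv_inv (a : G) : inv (inv a) = a :=
  comp_left_cancel (a := inv a) (by simp) (by simp) (by simp)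

theorem inv_comp_rev (a b : G) (h : src a = rng b) : inv (a ⋄ b) = inv b ⋄ inv a := by
  have h1 : src (inv b) = rng (inv a) := by simp [h]
  refine comp_left_cancel (a := a ⋄ b) (by simp) (by simp [rng_comp _ _ h1, src_comp _ _ h]) ?_
  rw [comp_inv, rng_comp _ _ h, comp_assoc _ _ _ h (by simp [rng_comp _ _ h1]),
    comp_inv_cancel_left _ _ (by simp [h]), comp_inv]

/-- The unit space `G⁽⁰⁾ = {γ γ⁻¹ : γ ∈ G}`. -/
def units (G : Type u) [ArrowGroupoid G] : Set G := Set.range (fun γ : G => γ ⋄ inv γ)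

theorem mem_units_iff {u : G} : u ∈ units G ↔ rng u = u :=
  ⟨by rintro ⟨γ, rfl⟩; simp, fun h => ⟨u, by simp [h]⟩⟩

theorem src_eq_of_mem {u : G} (h : u ∈ units G) : src u = u := by
  rw [← mem_units_iff.1 h, src_rng]

theorem src_mem (γ : G) : src γ ∈ units G := mem_units_iff.2 (by simp)

theorem rng_mem (γ : G) : rng γ ∈ units G := mem_units_iff.2 (by simp)

/-- The source map as a map onto the unit space. -/
def srcU (γ : G) : units G := ⟨src γ, src_mem γ⟩

/-- The range map as a map onto the unit space. -/
def rngU (γ : G) : units G := ⟨rng γ, rng_mem γ⟩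

/-- Inversion, as a bijection between a source fibre and a range fibre. -/
def invEquiv (u : G) : {γ : G // rng γ = u} ≃ {γ : G // src γ = u} where
  toFun γ := ⟨inv γ.1, by simp [γ.2]⟩
  invFun γ := ⟨inv γ.1, by simp [γ.2]⟩
  left_inv γ := by simp
  right_inv γ := by simp

/-- `γ ↦ β γ⁻¹`, a bijection from `{γ : s γ = s β}` to `{α : r α = r β}`. -/
def divEquiv (β : G) : {γ : G // src γ = src β} ≃ {α : G // rng α = rng β} where
  toFun γ := ⟨β ⋄ inv γ.1, by rw [rng_comp _ _ (by simp [γ.2])]⟩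
  invFun α := ⟨inv α.1 ⋄ β, by rw [src_comp _ _ (by simp [α.2])]⟩
  left_inv γ := by
    ext
    have h : src β = rng (inv γ.1) := by simp [γ.2]
    simp only [inv_comp_rev _ _ h, inv_inv]
    exact inv_comp_cancel_right _ _ γ.2
  right_inv α := by
    ext
    have h : src (inv α.1) = rng β := by simp [α.2]
    simp only [inv_comp_rev _ _ h, inv_inv]
    exact comp_inv_cancel_left _ _ α.2.symm

/-- `β ↦ β γ⁻¹`, a bijection from `{β : s β = s γ}` to `{α : s α = r γ}`. -/
def transEquiv (γ : G) : {β : G // src β = src γ} ≃ {α : G // src α = rng γ} where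
  toFun β := ⟨β.1 ⋄ inv γ, by rw [src_comp _ _ (by simp [β.2])]; simp⟩
  invFun α := ⟨α.1 ⋄ γ, by rw [src_comp _ _ α.2]⟩
  left_inv β := by ext; exact inv_comp_cancel_right _ _ β.2
  right_inv α := by ext; exact comp_inv_cancel_right _ _ α.2

/-- `γ ↦ α⁻¹ γ`, a bijection from `{γ : r γ = r α}` to `{β : r β = s α}`. -/
def leftEquiv (α : G) : {γ : G // rng γ = rng α} ≃ {β : G // rng β = src α} where
  toFun γ := ⟨inv α ⋄ γ.1, by rw [rng_comp _ _ (by simp [γ.2])]; simp⟩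
  invFun β := ⟨α ⋄ β.1, by rw [rng_comp _ _ β.2.symm]⟩
  left_inv γ := by ext; exact comp_inv_cancel_left _ _ γ.2.symm
  right_inv β := by ext; exact inv_comp_cancel_left _ _ β.2.symm

end Algebra

/-- A topological groupoid: range, source, inversion and composition (on the set of composable pairs)
are continuous. -/
class IsTopologicalGroupoid (G : Type u) [TopologicalSpace G] [ArrowGroupoid G] : Prop where
  continuous_src : Continuous (src : G → G)
  continuous_rng : Continuous (rng : G → G)
  continuous_inv : Continuous (inv : G → G)
  continuousOn_comp : ContinuousOn (fun p : G × G => p.1 ⋄ p.2) {p | src p.1 = rng p.2}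

/-- An étale groupoid: a topological groupoid whose range and source maps `G → G⁽⁰⁾` are local
homeomorphisms, for the relative topology of the unit space. -/
class IsEtaleGroupoid (G : Type u) [TopologicalSpace G] [ArrowGroupoid G] : Prop extends
    IsTopologicalGroupoid G where
  isLocalHomeomorph_src : IsLocalHomeomorph (srcU : G → units G)
  isLocalHomeomorph_rng : IsLocalHomeomorph (rngU : G → units G)

/-- `G` is topologically principal: the units `u` with trivial isotropy group
`{γ : r γ = s γ = u} = {u}` are dense in the unit space. -/
def IsTopologicallyPrincipal (G : Type u) [TopologicalSpace G] [ArrowGroupoid G] : Prop :=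
  Dense {u : units G | {γ : G | rng γ = u ∧ src γ = u} = {(u : G)}}

section Fibres

/-- Near a point `b` of the base, the fibres of a local homeomorphism `p` meet a compact set `K`
inside finitely many disjoint local sections. -/
theorem exists_local_sections {E B : Type u} [TopologicalSpace E] [TopologicalSpace B] [T2Space E]
    [T2Space B] {p : E → B} (hp : IsLocalHomeomorph p) {K : Set E} (hK : IsCompact K) (b : B) :
    ∃ (t : Finset E) (σ : E → B → E),
      (∀ e ∈ t, p e = b ∧ σ e b = e ∧ ContinuousAt (σ e) b) ∧
      ∀ᶠ b' in 𝓝 b, (∀ e ∈ t, p (σ e b') = b') ∧ Set.InjOn (fun e => σ e b') t ∧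
        ∀ x ∈ K, p x = b' → ∃ e ∈ t, σ e b' = x := by
  classical
  have hpc : Continuous p := hp.continuous
  choose φ hφ hpφ using hp
  have hKb : IsCompact (K ∩ p ⁻¹' {b}) := hK.inter_right (isClosed_singleton.preimage hpc)
  obtain ⟨t, htK, ht⟩ := hKb.elim_nhds_subcover (fun e => (φ e).source)
    (fun e _ => (φ e).open_source.mem_nhds (hφ e))
  have hpt : ∀ e ∈ t, p e = b := fun e he => (htK e he).2
  have hmem : ∀ e ∈ t, b ∈ (φ e).target := fun e he => by
    have := (φ e).map_source (hφ e)
    rwa [← hpφ e, hpt e he] at this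
  have hσb : ∀ e ∈ t, (φ e).symm b = e := fun e he => by
    have := (φ e).left_inv (hφ e)
    rwa [← hpφ e, hpt e he] at this
  have hσc : ∀ e ∈ t, ContinuousAt (φ e).symm b := fun e he => (φ e).continuousAt_symm (hmem e he)
  refine ⟨t, fun e => (φ e).symm, fun e he => ⟨hpt e he, hσb e he, hσc e he⟩, ?_⟩
  have hev : ∀ᶠ b' in 𝓝 b, ∀ e ∈ t, b' ∈ (φ e).target :=
    (Filter.eventually_all_finset t).2 fun e he => (φ e).open_target.mem_nhds (hmem e he)
  have hinj : ∀ᶠ b' in 𝓝 b, ∀ e ∈ t, ∀ e' ∈ t, e ≠ e' → (φ e).symm b' ≠ (φ e').symm b' := by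
    refine (Filter.eventually_all_finset t).2 fun e he =>
      (Filter.eventually_all_finset t).2 fun e' he' => ?_
    by_cases h : e = e'
    · simp [h]
    · have : ∀ᶠ b' in 𝓝 b, (φ e).symm b' ≠ (φ e').symm b' :=
        ((hσc e he).ne_iff_eventually_ne (hσc e' he')).1 (by rwa [hσb e he, hσb e' he'])
      filter_upwards [this] with b' hb' _ using hb'
  have hK' : IsCompact (K \ ⋃ e ∈ t, (φ e).source) :=
    hK.diff (isOpen_biUnion fun e _ => (φ e).open_source)
  have hout : ∀ᶠ b' in 𝓝 b, b' ∉ p '' (K \ ⋃ e ∈ t, (φ e).source) := by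
    refine (hK'.image hpc).isClosed.isOpen_compl.mem_nhds ?_
    rintro ⟨x, ⟨hxK, hx⟩, hxb⟩
    exact hx (ht ⟨hxK, hxb⟩)
  filter_upwards [hev, hinj, hout] with b' h1 h2 h3
  refine ⟨fun e he => ?_, fun e he e' he' h => ?_, fun x hx hxb => ?_⟩
  · have := (φ e).right_inv (h1 e he)
    rwa [← hpφ e] at this
  · by_contra hne
    exact h2 e he e' he' hne h
  · by_cases hxs : x ∈ ⋃ e ∈ t, (φ e).source
    · simp only [Set.mem_iUnion, exists_prop] at hxs
      obtain ⟨e, he, hxe⟩ := hxs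
      refine ⟨e, he, ?_⟩
      have := (φ e).left_inv hxe
      rwa [← hpφ e, hxb] at this
    · exact absurd ⟨x, ⟨hx, hxs⟩, hxb⟩ h3

/-- A sum over a fibre, computed through local sections. -/
theorem tsum_fibre_eq {E B M : Type*} [AddCommMonoid M] [TopologicalSpace M] {q : E → B}
    {b : B} {t : Finset E} {σ : E → E} {h : E → M} (h1 : ∀ e ∈ t, q (σ e) = b)
    (h2 : Set.InjOn σ t) (h3 : ∀ x, h x ≠ 0 → q x = b → ∃ e ∈ t, σ e = x) :
    ∑' x : {x : E // q x = b}, h x = ∑ e ∈ t, h (σ e) := by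
  classical
  rw [← Finset.sum_image (s := t) (g := σ) (f := h) h2]
  have : ∑' x : {x : E // q x = b}, h x = ∑ x ∈ (t.image σ).subtype (fun x => q x = b), h x := by
    refine tsum_eq_sum fun x hx => ?_
    by_contra hne
    obtain ⟨e, he, hex⟩ := h3 x hne x.2
    exact hx (by simp only [Finset.mem_subtype, Finset.mem_image]; exact ⟨e, he, hex⟩)
  rw [this, Finset.sum_subtype_eq_sum_filter, Finset.filter_true_of_mem]
  simp only [Finset.mem_image]
  rintro _ ⟨e, he, rfl⟩
  exact h1 e he

end Fibres


/-! Operators on `ℓ²(ι)` given by a matrix with uniformly summable rows and columns. -/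

section Schur

variable {ι : Type u}

/-- The Hilbert space `ℓ²(ι)`. -/
abbrev Ell2 (ι : Type u) : Type u := lp (fun _ : ι => ℂ) 2

theorem memℓp_two_of_tsum {f : ι → ℂ} (h : ∑' i, ‖f i‖ₑ ^ 2 < ⊤) : Memℓp f 2 := by
  refine memℓp_gen ?_
  have h2 : Summable fun i => (‖f i‖₊ ^ 2 : ℝ≥0) := by
    rw [← ENNReal.tsum_coe_ne_top_iff_summable]
    simpa [enorm_eq_nnnorm] using h.ne
  simpa using NNReal.summable_coe.2 h2

theorem enorm_ell2_sq (ξ : Ell2 ι) : ‖ξ‖ₑ ^ 2 = ∑' i, ‖ξ i‖ₑ ^ 2 := by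
  have h := lp.hasSum_norm (p := 2) (by norm_num) ξ
  simp only [ENNReal.toReal_ofNat, Real.rpow_ofNat] at h
  have h2 : HasSum (fun i => (‖ξ i‖₊ ^ 2 : ℝ≥0)) (‖ξ‖₊ ^ 2) := by
    rw [← NNReal.hasSum_coe]; simpa using h
  have h3 := ENNReal.hasSum_coe.2 h2
  simpa [enorm_eq_nnnorm] using h3.tsum_eq.symm

theorem ENNReal_tsum_mul_sq_le (k a : ι → ℝ≥0∞) :
    (∑' j, k j * a j) ^ 2 ≤ (∑' j, k j) * ∑' j, k j * a j ^ 2 := by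
  let _ : MeasurableSpace ι := ⊤
  have hpq : Real.HolderConjugate 2 2 := Real.HolderConjugate.two_two
  have h := ENNReal.lintegral_mul_le_Lp_mul_Lq (MeasureTheory.Measure.count : MeasureTheory.Measure ι)
    hpq (f := fun j => k j ^ (1 / 2 : ℝ)) (g := fun j => k j ^ (1 / 2 : ℝ) * a j)
    (Measurable.of_discrete.aemeasurable) (Measurable.of_discrete.aemeasurable)
  have hk : ∀ x : ℝ≥0∞, x ^ (1 / 2 : ℝ) * x ^ (1 / 2 : ℝ) = x := fun x => by
    rw [← ENNReal.rpow_add_of_nonneg _ _ (by norm_num) (by norm_num)]; norm_num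
  have hk2 : ∀ x : ℝ≥0∞, (x ^ (1 / 2 : ℝ)) ^ 2 = x := fun x => by rw [sq, hk]
  simp only [MeasureTheory.lintegral_count, Pi.mul_apply, ← mul_assoc, hk, ENNReal.rpow_ofNat,
    hk2, mul_pow] at h
  calc _ ≤ _ := pow_le_pow_left' h 2
    _ = _ := by rw [mul_pow, hk2, hk2]

theorem ENNReal_schur_bound (k : ι → ι → ℝ≥0∞) (C : ℝ≥0∞) (h1 : ∀ i, ∑' j, k i j ≤ C)
    (h2 : ∀ j, ∑' i, k i j ≤ C) (a : ι → ℝ≥0∞) :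
    ∑' i, (∑' j, k i j * a j) ^ 2 ≤ C ^ 2 * ∑' j, a j ^ 2 := by
  calc ∑' i, (∑' j, k i j * a j) ^ 2 ≤ ∑' i, C * ∑' j, k i j * a j ^ 2 :=
        ENNReal.tsum_le_tsum fun i => (ENNReal_tsum_mul_sq_le _ _).trans (by gcongr; exact h1 i)
    _ = C * ∑' j, (∑' i, k i j) * a j ^ 2 := by
        rw [ENNReal.tsum_mul_left, ENNReal.tsum_comm]; simp_rw [ENNReal.tsum_mul_right]
    _ ≤ C * ∑' j, C * a j ^ 2 := by
        gcongr with j; exact h2 j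
    _ = _ := by rw [ENNReal.tsum_mul_left]; ring

theorem schur_summable {k : ι → ι → ℂ} {C : ℝ≥0} (h1 : ∀ i, ∑' j, ‖k i j‖ₑ ≤ C) (ξ : Ell2 ι) (i : ι) :
    Summable fun j => k i j * ξ j := by
  have hk : Summable fun j => ‖k i j‖ := by
    have : Summable fun j => ‖k i j‖₊ := by
      rw [← ENNReal.tsum_coe_ne_top_iff_summable]
      exact ((h1 i).trans_lt ENNReal.coe_lt_top).ne
    exact NNReal.summable_coe.2 this
  refine Summable.of_norm_bounded (hk.mul_right ‖ξ‖) fun j => ?_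
  rw [norm_mul]
  gcongr
  exact lp.norm_apply_le_norm (by norm_num) ξ j

theorem schur_enorm_le {k : ι → ι → ℂ} {C : ℝ≥0} (h1 : ∀ i, ∑' j, ‖k i j‖ₑ ≤ C)
    (h2 : ∀ j, ∑' i, ‖k i j‖ₑ ≤ C) (ξ : Ell2 ι) :
    ∑' i, ‖∑' j, k i j * ξ j‖ₑ ^ 2 ≤ (C : ℝ≥0∞) ^ 2 * ‖ξ‖ₑ ^ 2 := by
  rw [enorm_ell2_sq]
  refine le_trans (ENNReal.tsum_le_tsum fun i => ?_)
    (ENNReal_schur_bound (fun i j => ‖k i j‖ₑ) C h1 h2 fun j => ‖ξ j‖ₑ)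
  gcongr
  refine enorm_tsum_le_tsum_enorm.trans_eq ?_
  simp_rw [enorm_mul]

/-- The bounded operator `(k ξ)(i) = ∑ⱼ k i j * ξ j` on `ℓ²(ι)`. -/
def schurOp (k : ι → ι → ℂ) (C : ℝ≥0) (h1 : ∀ i, ∑' j, ‖k i j‖ₑ ≤ C)
    (h2 : ∀ j, ∑' i, ‖k i j‖ₑ ≤ C) : Ell2 ι →L[ℂ] Ell2 ι :=
  LinearMap.mkContinuous
    { toFun := fun ξ => ⟨fun i => ∑' j, k i j * ξ j, memℓp_two_of_tsum
        ((schur_enorm_le h1 h2 ξ).trans_lt (ENNReal.mul_lt_top (by simp) (by simp)))⟩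
      map_add' := fun ξ η => by
        ext i
        simp only [lp.coeFn_add, Pi.add_apply, mul_add]
        exact (schur_summable h1 ξ i).tsum_add (schur_summable h1 η i)
      map_smul' := fun c ξ => by
        ext i
        simp only [lp.coeFn_smul, Pi.smul_apply, smul_eq_mul, RingHom.id_apply, mul_left_comm _ c]
        exact tsum_mul_left } C
    (fun ξ => by
      have h := schur_enorm_le h1 h2 ξ
      rw [← mul_pow] at h
      have h' : ‖(⟨fun i => ∑' j, k i j * ξ j, memℓp_two_of_tsum
        ((schur_enorm_le h1 h2 ξ).trans_lt (ENNReal.mul_lt_top (by simp) (by simp)))⟩ : Ell2 ι)‖ₑ ^ 2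
          ≤ (C * ‖ξ‖ₑ) ^ 2 := by rw [enorm_ell2_sq]; exact h
      have h'' := (ENNReal.pow_le_pow_left_iff two_ne_zero).1 h'
      simp only [enorm_eq_nnnorm] at h''
      exact_mod_cast h'')

theorem schurOp_apply (k : ι → ι → ℂ) (C : ℝ≥0) (h1 : ∀ i, ∑' j, ‖k i j‖ₑ ≤ C)
    (h2 : ∀ j, ∑' i, ‖k i j‖ₑ ≤ C) (ξ : Ell2 ι) (i : ι) :
    schurOp k C h1 h2 ξ i = ∑' j, k i j * ξ j := rfl

theorem schurOp_norm_le (k : ι → ι → ℂ) (C : ℝ≥0) (h1 : ∀ i, ∑' j, ‖k i j‖ₑ ≤ C)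
    (h2 : ∀ j, ∑' i, ‖k i j‖ₑ ≤ C) : ‖schurOp k C h1 h2‖ ≤ C :=
  LinearMap.mkContinuous_norm_le _ C.2 _

open Classical in
/-- The canonical basis vector `δ_j` of `ℓ²(ι)`. -/
def delta (j : ι) : Ell2 ι := lp.single 2 j (1 : ℂ)

theorem schurOp_delta (k : ι → ι → ℂ) (C : ℝ≥0) (h1 : ∀ i, ∑' j, ‖k i j‖ₑ ≤ C)
    (h2 : ∀ j, ∑' i, ‖k i j‖ₑ ≤ C) (i j : ι) :
    schurOp k C h1 h2 (delta j) i = k i j := by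
  classical
  rw [schurOp_apply, tsum_eq_single j fun j' hj' => by simp [delta, hj']]
  simp [delta]

theorem ell2_op_ext {S T : Ell2 ι →L[ℂ] Ell2 ι} (h : ∀ i j, S (delta j) i = T (delta j) i) :
    S = T := by
  classical
  refine lp.ext_continuousLinearMap (by norm_num) fun j => ?_
  ext i
  have := h i j
  simpa [delta] using this

theorem inner_delta_left (i : ι) (ξ : Ell2 ι) : inner ℂ (delta i) ξ = ξ i := by
  classical
  simp [delta, lp.inner_single_left]

theorem adjoint_delta (T : Ell2 ι →L[ℂ] Ell2 ι) (i j : ι) :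
    (star T) (delta j) i = star (T (delta i) j) := by
  rw [← inner_delta_left, ContinuousLinearMap.star_eq_adjoint,
    ContinuousLinearMap.adjoint_inner_right, ← inner_conj_symm, inner_delta_left]
  rfl

end Schur

/-! The convolution algebra. -/

section INorm

variable {G : Type u} [ArrowGroupoid G]

/-- The `I`-norm `sup_u max {∑_{s γ = u} |f γ|, ∑_{r γ = u} |f γ|}`, as an extended nonnegative real
(it is finite on `C_c(G)` for étale `G`). -/
def iNorm (f : G → ℂ) : ℝ≥0∞ :=
  ⨆ u : units G, max (∑' γ : {γ : G // src γ = u}, ‖f γ‖ₑ) (∑' γ : {γ : G // rng γ = u}, ‖f γ‖ₑ)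

theorem tsum_src_le_iNorm (f : G → ℂ) {u : G} (hu : u ∈ units G) :
    ∑' γ : {γ : G // src γ = u}, ‖f γ‖ₑ ≤ iNorm f :=
  (le_max_left _ _).trans (le_iSup (fun u : units G => max (∑' γ : {γ : G // src γ = u}, ‖f γ‖ₑ)
    (∑' γ : {γ : G // rng γ = u}, ‖f γ‖ₑ)) ⟨u, hu⟩)

theorem tsum_rng_le_iNorm (f : G → ℂ) {u : G} (hu : u ∈ units G) :
    ∑' γ : {γ : G // rng γ = u}, ‖f γ‖ₑ ≤ iNorm f :=
  (le_max_right _ _).trans (le_iSup (fun u : units G => max (∑' γ : {γ : G // src γ = u}, ‖f γ‖ₑ)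
    (∑' γ : {γ : G // rng γ = u}, ‖f γ‖ₑ)) ⟨u, hu⟩)

end INorm

section ConvolutionAlgebra

/-- The space `C_c(G)` of compactly supported continuous functions on a groupoid; it carries the
convolution product and the involution of `G`, not the pointwise ones. -/
def CcAlg (G : Type u) [TopologicalSpace G] : Type u := C_c(G, ℂ)

variable {G : Type u} [TopologicalSpace G]

instance : AddCommGroup (CcAlg G) := inferInstanceAs (AddCommGroup C_c(G, ℂ))
instance : Module ℂ (CcAlg G) := inferInstanceAs (Module ℂ C_c(G, ℂ))
instance : FunLike (CcAlg G) G ℂ := inferInstanceAs (FunLike C_c(G, ℂ) G ℂ)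

namespace CcAlg

theorem continuous (f : CcAlg G) : Continuous f := f.toContinuousMap.continuous
theorem hasCompactSupport (f : CcAlg G) : HasCompactSupport f := f.hasCompactSupport'
theorem isCompact_tsupport (f : CcAlg G) : IsCompact (tsupport f) := f.hasCompactSupport
@[simp] theorem add_apply (f g : CcAlg G) (γ : G) : (f + g) γ = f γ + g γ := rfl
@[simp] theorem smul_apply (c : ℂ) (f : CcAlg G) (γ : G) : (c • f) γ = c * f γ := rfl
@[simp] theorem zero_apply (γ : G) : (0 : CcAlg G) γ = 0 := rfl
@[ext] theorem ext {f g : CcAlg G} (h : ∀ γ, f γ = g γ) : f = g := DFunLike.ext _ _ h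

end CcAlg

variable [ArrowGroupoid G]

variable [IsEtaleGroupoid G]

theorem continuous_rngU : Continuous (rngU : G → units G) :=
  IsEtaleGroupoid.isLocalHomeomorph_rng.continuous

theorem continuous_inv' : Continuous (inv : G → G) := IsTopologicalGroupoid.continuous_inv

variable [T2Space G]

/-- Near a given unit, the sums over range fibres of functions that vanish off a compact set are finite
sums over continuous local sections. -/
theorem exists_sections {K : Set G} (hK : IsCompact K) (u : units G) :
    ∃ (t : Finset G) (σ : G → units G → G),
      (∀ e ∈ t, rngU e = u ∧ σ e u = e ∧ ContinuousAt (σ e) u) ∧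
      ∀ᶠ v : units G in 𝓝 u, (∀ e ∈ t, rng (σ e v) = v) ∧
        ∀ (M : Type) [AddCommMonoid M] [TopologicalSpace M] (h : G → M), (∀ γ ∉ K, h γ = 0) →
          ∑' γ : {γ : G // rng γ = v}, h γ = ∑ e ∈ t, h (σ e v) := by
  obtain ⟨t, σ, h1, h2⟩ := exists_local_sections
    (IsEtaleGroupoid.isLocalHomeomorph_rng (G := G)) hK u
  refine ⟨t, σ, h1, ?_⟩
  filter_upwards [h2] with v hv
  obtain ⟨ha, hb, hc⟩ := hv
  have ha' : ∀ e ∈ t, rng (σ e v) = v := fun e he => congrArg Subtype.val (ha e he)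
  refine ⟨ha', fun M _ _ h hh => ?_⟩
  refine tsum_fibre_eq (q := rng) ha' hb fun γ hγ hγv => hc γ ?_ (Subtype.ext hγv)
  by_contra hK
  exact hγ (hh γ hK)

/-- The convolution `(f * g)(γ) = ∑_{r α = r γ} f(α) g(α⁻¹ γ)`. -/
def convFun (f g : G → ℂ) (γ : G) : ℂ :=
  ∑' α : {α : G // rng α = rng γ}, f α * g (inv α ⋄ γ)

theorem convFun_continuous (f g : CcAlg G) : Continuous (convFun f g) := by
  refine continuous_iff_continuousAt.2 fun γ₀ => ?_
  obtain ⟨t, σ, h1, h2⟩ := exists_sections f.isCompact_tsupport (rngU γ₀)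
  have h3 := (continuous_rngU (G := G)).continuousAt.eventually h2
  have hev : (fun γ => ∑ e ∈ t, f (σ e (rngU γ)) * g (inv (σ e (rngU γ)) ⋄ γ)) =ᶠ[𝓝 γ₀]
      convFun f g := by
    filter_upwards [h3] with γ hγ
    refine (hγ.2 ℂ (fun α => f α * g (inv α ⋄ γ)) fun α hα => ?_).symm
    rw [image_eq_zero_of_notMem_tsupport hα, zero_mul]
  refine ContinuousAt.congr ?_ hev
  refine tendsto_finsetSum _ fun e he => ?_
  obtain ⟨he1, he2, he3⟩ := h1 e he
  have hσ : ContinuousAt (fun γ : G => σ e (rngU γ)) γ₀ :=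
    ContinuousAt.comp (f := rngU) (g := σ e) he3 continuous_rngU.continuousAt
  refine Filter.Tendsto.mul (f.continuous.continuousAt.comp hσ) ?_
  have hp : Filter.Tendsto (fun γ : G => (inv (σ e (rngU γ)), γ)) (𝓝 γ₀)
      (𝓝[{p : G × G | src p.1 = rng p.2}] (inv (σ e (rngU γ₀)), γ₀)) := by
    refine tendsto_nhdsWithin_iff.2 ⟨?_, ?_⟩
    · exact ((continuous_inv'.continuousAt.comp hσ).prodMk continuousAt_id)
    · filter_upwards [h3] with γ hγ
      exact (src_inv _).trans (hγ.1 e he)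
  have hmem : ((inv (σ e (rngU γ₀)), γ₀) : G × G) ∈ {p : G × G | src p.1 = rng p.2} := by
    have h : rng e = rng γ₀ := congrArg Subtype.val he1
    simpa [he2] using h
  have hc := (IsTopologicalGroupoid.continuousOn_comp (G := G)) _ hmem
  exact (g.continuous.tendsto _).comp (hc.tendsto.comp hp)

theorem convFun_hasCompactSupport (f g : CcAlg G) : HasCompactSupport (convFun f g) := by
  have hcl : IsClosed {p : G × G | src p.1 = rng p.2} :=
    isClosed_eq (IsTopologicalGroupoid.continuous_src.comp continuous_fst)
      (IsTopologicalGroupoid.continuous_rng.comp continuous_snd)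
  have hK : IsCompact ((tsupport f ×ˢ tsupport g) ∩ {p : G × G | src p.1 = rng p.2}) :=
    (f.isCompact_tsupport.prod g.isCompact_tsupport).inter_right hcl
  refine HasCompactSupport.intro (hK.image_of_continuousOn
    ((IsTopologicalGroupoid.continuousOn_comp (G := G)).mono Set.inter_subset_right))
    fun γ hγ => ?_
  refine (tsum_congr fun α => ?_).trans tsum_zero
  by_contra hne
  refine hγ ⟨(α.1, inv α.1 ⋄ γ), ⟨⟨?_, ?_⟩, ?_⟩, comp_inv_cancel_left _ _ α.2⟩
  · exact subset_tsupport _ (left_ne_zero_of_mul hne)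
  · exact subset_tsupport _ (right_ne_zero_of_mul hne)
  · have : src (inv α.1) = rng γ := by simp [α.2]
    simp [rng_comp _ _ this]

instance : Mul (CcAlg G) where
  mul f g := ⟨⟨convFun f g, convFun_continuous f g⟩, convFun_hasCompactSupport f g⟩

theorem CcAlg.mul_apply (f g : CcAlg G) (γ : G) :
    (f * g) γ = ∑' α : {α : G // rng α = rng γ}, f α * g (inv α ⋄ γ) := rfl

/-- The involution `f*(γ) = conj (f (γ⁻¹))`. -/
instance : Star (CcAlg G) where
  star f :=
    { toFun := fun γ => star (f (inv γ))
      continuous_toFun := (f.continuous.comp continuous_inv').star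
      hasCompactSupport' := by
        refine HasCompactSupport.intro (f.isCompact_tsupport.image (continuous_inv' (G := G)))
          fun γ hγ => ?_
        have : inv γ ∉ tsupport f := fun h => hγ ⟨inv γ, h, inv_inv γ⟩
        rw [image_eq_zero_of_notMem_tsupport this, star_zero] }

theorem CcAlg.star_apply (f : CcAlg G) (γ : G) : (star f) γ = star (f (inv γ)) := rfl

theorem exists_rng_bound (f : CcAlg G) :
    ∃ C : ℝ≥0, ∀ u : units G, ∑' γ : {γ : G // rng γ = u}, ‖f γ‖ₑ ≤ C := by
  obtain ⟨D, hD⟩ := (f.hasCompactSupport.isCompact_range f.continuous).isBounded.exists_norm_le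
  have hD' : ∀ γ, ‖f γ‖ₑ ≤ (D.toNNReal : ℝ≥0∞) := fun γ => by
    rw [← ofReal_norm]
    exact ENNReal.ofReal_le_ofReal (hD _ ⟨γ, rfl⟩)
  have key : ∃ C : ℝ≥0, ∀ u ∈ (rngU : G → units G) '' tsupport f,
      ∑' γ : {γ : G // rng γ = u}, ‖f γ‖ₑ ≤ C := by
    refine IsCompact.induction_on
      (p := fun s => ∃ C : ℝ≥0, ∀ u ∈ s, ∑' γ : {γ : G // rng γ = u}, ‖f γ‖ₑ ≤ C)
      (f.isCompact_tsupport.image continuous_rngU) ⟨0, by simp⟩ ?_ ?_ ?_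
    · rintro s t hst ⟨C, hC⟩
      exact ⟨C, fun u hu => hC u (hst hu)⟩
    · rintro s t ⟨C, hC⟩ ⟨C', hC'⟩
      refine ⟨max C C', fun u hu => ?_⟩
      rw [ENNReal.coe_max]
      rcases hu with hu | hu
      · exact (hC u hu).trans (le_max_left _ _)
      · exact (hC' u hu).trans (le_max_right _ _)
    · intro u _
      obtain ⟨t, σ, -, h2⟩ := exists_sections f.isCompact_tsupport u
      refine ⟨_, mem_nhdsWithin_of_mem_nhds h2, t.card * D.toNNReal, fun v hv => ?_⟩
      rw [hv.2 ℝ≥0∞ (fun γ => ‖f γ‖ₑ) fun γ hγ => by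
        simp [image_eq_zero_of_notMem_tsupport hγ]]
      refine (Finset.sum_le_card_nsmul _ _ _ fun e _ => hD' _).trans ?_
      simp
  obtain ⟨C, hC⟩ := key
  refine ⟨C, fun u => ?_⟩
  by_cases hu : u ∈ (rngU : G → units G) '' tsupport f
  · exact hC u hu
  · refine le_of_eq_of_le ((tsum_congr fun γ => ?_).trans tsum_zero) (zero_le (a := (C : ℝ≥0∞)))
    have : γ.1 ∉ tsupport f := fun h => hu ⟨γ, h, Subtype.ext γ.2⟩
    simp [image_eq_zero_of_notMem_tsupport this]

theorem tsum_src_eq (f : CcAlg G) (u : G) :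
    ∑' γ : {γ : G // src γ = u}, ‖f γ‖ₑ = ∑' γ : {γ : G // rng γ = u}, ‖(star f) γ‖ₑ := by
  rw [← (invEquiv u).tsum_eq]
  simp [invEquiv, CcAlg.star_apply, enorm_eq_nnnorm]

theorem iNorm_lt_top (f : CcAlg G) : iNorm f < ⊤ := by
  obtain ⟨C, hC⟩ := exists_rng_bound f
  obtain ⟨C', hC'⟩ := exists_rng_bound (star f)
  refine lt_of_le_of_lt (b := ((max C C' : ℝ≥0) : ℝ≥0∞)) (iSup_le fun u => max_le ?_ ?_)
    ENNReal.coe_lt_top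
  · rw [tsum_src_eq, ENNReal.coe_max]; exact (hC' u).trans (le_max_right _ _)
  · rw [ENNReal.coe_max]; exact (hC u).trans (le_max_left _ _)

theorem coe_toNNReal_iNorm (f : CcAlg G) : ((iNorm f).toNNReal : ℝ≥0∞) = iNorm f :=
  ENNReal.coe_toNNReal (iNorm_lt_top f).ne

/-- The source fibre `G_u`. -/
abbrev SrcFibre (u : units G) : Type u := {γ : G // src γ = u}

theorem reg_rows (f : CcAlg G) (u : units G) (β : SrcFibre u) :
    ∑' γ : SrcFibre u, ‖f (β.1 ⋄ inv γ.1)‖ₑ ≤ (iNorm f).toNNReal := by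
  obtain ⟨β, hβ⟩ := β
  obtain rfl : u = ⟨src β, src_mem β⟩ := Subtype.ext hβ.symm
  rw [coe_toNNReal_iNorm]
  refine le_of_eq_of_le ?_ (tsum_rng_le_iNorm f (rng_mem β))
  exact (divEquiv β).tsum_eq fun α => ‖f α‖ₑ

theorem reg_cols (f : CcAlg G) (u : units G) (γ : SrcFibre u) :
    ∑' β : SrcFibre u, ‖f (β.1 ⋄ inv γ.1)‖ₑ ≤ (iNorm f).toNNReal := by
  obtain ⟨γ, hγ⟩ := γ
  obtain rfl : u = ⟨src γ, src_mem γ⟩ := Subtype.ext hγ.symm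
  rw [coe_toNNReal_iNorm]
  refine le_of_eq_of_le ?_ (tsum_src_le_iNorm f (rng_mem γ))
  exact (transEquiv γ).tsum_eq fun α => ‖f α‖ₑ

/-- The regular representation on `ℓ²(G_u)`, by convolution:
`(Ind_u(f) ξ)(β) = ∑_{γ ∈ G_u} f(β γ⁻¹) ξ(γ)`. -/
def regOp (u : units G) (f : CcAlg G) : Ell2 (SrcFibre u) →L[ℂ] Ell2 (SrcFibre u) :=
  schurOp (fun β γ => f (β.1 ⋄ inv γ.1)) (iNorm f).toNNReal (reg_rows f u) (reg_cols f u)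

theorem regOp_delta (u : units G) (f : CcAlg G) (β γ : SrcFibre u) :
    regOp u f (delta γ) β = f (β.1 ⋄ inv γ.1) := schurOp_delta _ _ _ _ _ _

theorem regOp_add (u : units G) (f g : CcAlg G) : regOp u (f + g) = regOp u f + regOp u g :=
  ell2_op_ext fun i j => by simp [regOp_delta]

theorem regOp_smul (u : units G) (c : ℂ) (f : CcAlg G) : regOp u (c • f) = c • regOp u f :=
  ell2_op_ext fun i j => by simp [regOp_delta]

theorem regOp_mul (u : units G) (f g : CcAlg G) : regOp u (f * g) = regOp u f * regOp u g :=
  ell2_op_ext fun β γ => by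
    have hβ : src β.1 = rng (inv γ.1) := by simp [β.2, γ.2]
    have : (regOp u f * regOp u g) (delta γ) β = ∑' η : SrcFibre u,
        f (β.1 ⋄ inv η.1) * g (η.1 ⋄ inv γ.1) := by
      rw [mul_apply_eq_comp, regOp, schurOp_apply]
      simp_rw [regOp_delta]
    rw [this, regOp_delta, CcAlg.mul_apply]
    obtain ⟨β, hβu⟩ := β
    obtain rfl : u = ⟨src β, src_mem β⟩ := Subtype.ext hβu.symm
    dsimp only at hβ ⊢
    rw [rng_comp _ _ hβ, ← (divEquiv β).tsum_eq]
    refine tsum_congr fun η => ?_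
    have hη : src β = rng (inv η.1) := by simp [η.2]
    have h1 : inv (β ⋄ inv η.1) ⋄ (β ⋄ inv γ.1) = η.1 ⋄ inv γ.1 := by
      rw [← comp_assoc _ _ _ (by simp [rng_comp _ _ hη]) hβ, inv_comp_rev _ _ hη, inv_inv,
        inv_comp_cancel_right _ _ η.2]
    simp [divEquiv, h1]

theorem regOp_star (u : units G) (f : CcAlg G) : regOp u (star f) = star (regOp u f) :=
  ell2_op_ext fun β γ => by
    have h : src β.1 = rng (inv γ.1) := by simp [β.2, γ.2]
    rw [adjoint_delta, regOp_delta, regOp_delta, CcAlg.star_apply, inv_comp_rev _ _ h, inv_inv]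

theorem regOp_zero (u : units G) : regOp u (0 : CcAlg G) = 0 :=
  ell2_op_ext fun i j => by simp [regOp_delta]

theorem regOp_injective :
    Function.Injective fun (f : CcAlg G) (u : units G) => regOp u f := by
  intro f g h
  ext γ
  have h1 := congrFun h ⟨src γ, src_mem γ⟩
  have h2 := congrArg (fun T => T (delta ⟨src γ, by simp⟩) ⟨γ, rfl⟩) h1
  simp only [regOp_delta] at h2
  have h3 : γ ⋄ inv (src γ) = γ := by
    have : inv (src γ) = src γ := by
      have := comp_src (inv (src γ))
      rw [src_inv, rng_src] at this
      have h4 := inv_comp (src γ)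
      rw [this, src_src] at h4
      exact h4
    rw [this, comp_src]
  simpa [h3] using h2

instance : NonUnitalRing (CcAlg G) where
  left_distrib f g h := regOp_injective (funext fun u => by
    simp only [regOp_mul, regOp_add, mul_add])
  right_distrib f g h := regOp_injective (funext fun u => by
    simp only [regOp_mul, regOp_add, add_mul])
  zero_mul f := regOp_injective (funext fun u => by simp only [regOp_mul, regOp_zero, zero_mul])
  mul_zero f := regOp_injective (funext fun u => by simp only [regOp_mul, regOp_zero, mul_zero])
  mul_assoc f g h := regOp_injective (funext fun u => by simp only [regOp_mul, mul_assoc])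

instance : IsScalarTower ℂ (CcAlg G) (CcAlg G) where
  smul_assoc c f g := regOp_injective (funext fun u => by
    simp only [smul_eq_mul, regOp_mul, regOp_smul, smul_mul_assoc])

instance : SMulCommClass ℂ (CcAlg G) (CcAlg G) where
  smul_comm c f g := regOp_injective (funext fun u => by
    simp only [smul_eq_mul, regOp_mul, regOp_smul, mul_smul_comm])

instance : StarRing (CcAlg G) where
  star_involutive f := by ext γ; simp [CcAlg.star_apply]
  star_mul f g := regOp_injective (funext fun u => by simp only [regOp_mul, regOp_star, star_mul])
  star_add f g := by ext γ; simp [CcAlg.star_apply]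

instance : StarModule ℂ (CcAlg G) where
  star_smul c f := by ext γ; simp [CcAlg.star_apply]

/-- The regular representation `Ind_u` of the `*`-algebra `C_c(G)` on `ℓ²(G_u)`. -/
def regRep (u : units G) : CcAlg G →⋆ₙₐ[ℂ] (Ell2 (SrcFibre u) →L[ℂ] Ell2 (SrcFibre u)) where
  toFun := regOp u
  map_smul' := regOp_smul u
  map_zero' := regOp_zero u
  map_add' := regOp_add u
  map_mul' := regOp_mul u
  map_star' := regOp_star u

theorem regRep_norm_le (u : units G) (f : CcAlg G) : ‖regRep u f‖ ≤ (iNorm f).toReal :=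
  schurOp_norm_le _ _ (reg_rows f u) (reg_cols f u)

end ConvolutionAlgebra

section INormEstimates

variable {G : Type u} [TopologicalSpace G] [ArrowGroupoid G] [IsEtaleGroupoid G] [T2Space G]

theorem iNorm_star_le (f : CcAlg G) : iNorm (star f : CcAlg G) ≤ iNorm f := by
  refine iSup_le fun u => max_le ?_ ?_
  · rw [tsum_src_eq, star_star]; exact tsum_rng_le_iNorm f u.2
  · rw [← tsum_src_eq]; exact tsum_src_le_iNorm f u.2

theorem tsum_rng_mul_le (f g : CcAlg G) {u : G} (hu : u ∈ units G) :
    ∑' γ : {γ : G // rng γ = u}, ‖(f * g) γ‖ₑ ≤ iNorm f * iNorm g := by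
  calc ∑' γ : {γ : G // rng γ = u}, ‖(f * g) γ‖ₑ
      ≤ ∑' γ : {γ : G // rng γ = u}, ∑' α : {α : G // rng α = u}, ‖f α‖ₑ * ‖g (inv α.1 ⋄ γ)‖ₑ := by
        refine ENNReal.tsum_le_tsum fun γ => ?_
        obtain ⟨γ, rfl⟩ := γ
        rw [CcAlg.mul_apply]
        refine enorm_tsum_le_tsum_enorm.trans_eq ?_
        simp_rw [enorm_mul]
    _ = ∑' α : {α : G // rng α = u}, ‖f α‖ₑ * ∑' γ : {γ : G // rng γ = u}, ‖g (inv α.1 ⋄ γ)‖ₑ := by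
        rw [ENNReal.tsum_comm]; simp_rw [ENNReal.tsum_mul_left]
    _ ≤ ∑' α : {α : G // rng α = u}, ‖f α‖ₑ * iNorm g := by
        refine ENNReal.tsum_le_tsum fun α => ?_
        gcongr
        obtain ⟨α, rfl⟩ := α
        exact le_of_eq_of_le ((leftEquiv α).tsum_eq fun β => ‖g β‖ₑ) (tsum_rng_le_iNorm g (src_mem α))
    _ ≤ iNorm f * iNorm g := by
        rw [ENNReal.tsum_mul_right]
        gcongr
        exact tsum_rng_le_iNorm f hu

theorem iNorm_mul_le (f g : CcAlg G) : iNorm (f * g) ≤ iNorm f * iNorm g := by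
  refine iSup_le fun u => max_le ?_ (tsum_rng_mul_le f g u.2)
  rw [tsum_src_eq, star_mul]
  refine (tsum_rng_mul_le _ _ u.2).trans ?_
  rw [mul_comm]
  exact mul_le_mul' (iNorm_star_le f) (iNorm_star_le g)

/-- A `*`-representation of `C_c(G)` on a Hilbert space that is bounded for the `I`-norm. The Hilbert
space is taken in the universe of `G`; since every cyclic representation of `C_c(G)` lives on a space
of this kind up to unitary equivalence, this does not affect the supremum of the norms. -/
structure BddRep (G : Type u) [TopologicalSpace G] [ArrowGroupoid G] [IsEtaleGroupoid G]
    [T2Space G] : Type (u + 1) where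
  H : Type u
  [normedAddCommGroup : NormedAddCommGroup H]
  [innerProductSpace : InnerProductSpace ℂ H]
  [completeSpace : CompleteSpace H]
  π : CcAlg G →⋆ₙₐ[ℂ] (H →L[ℂ] H)
  bounded : ∃ C : ℝ≥0, ∀ f : CcAlg G, ‖π f‖ₑ ≤ C * iNorm f

attribute [instance] BddRep.normedAddCommGroup BddRep.innerProductSpace BddRep.completeSpace

theorem toReal_iNorm_mul_le (f g : CcAlg G) :
    (iNorm (f * g)).toReal ≤ (iNorm f).toReal * (iNorm g).toReal := by
  rw [← ENNReal.toReal_mul]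
  exact ENNReal.toReal_mono (ENNReal.mul_lt_top (iNorm_lt_top f) (iNorm_lt_top g)).ne
    (iNorm_mul_le f g)

/-- Bounded representations are `I`-norm decreasing. -/
theorem BddRep.norm_le (ρ : BddRep G) (f : CcAlg G) : ‖ρ.π f‖ ≤ (iNorm f).toReal := by
  obtain ⟨C, hC⟩ := ρ.bounded
  have hC' : ∀ f, ‖ρ.π f‖ ≤ C * (iNorm f).toReal := fun f => by
    have h := ENNReal.toReal_mono (ENNReal.mul_lt_top ENNReal.coe_lt_top (iNorm_lt_top f)).ne (hC f)
    simpa [ENNReal.toReal_mul] using h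
  have hstar : ∀ h : CcAlg G, star h = h → ‖ρ.π h‖ ≤ (iNorm h).toReal := by
    intro h hh
    have key : ∀ n : ℕ, ∃ k : CcAlg G, star k = k ∧ ‖ρ.π k‖ = ‖ρ.π h‖ ^ (2 ^ n) ∧
        (iNorm k).toReal ≤ (iNorm h).toReal ^ (2 ^ n) := by
      intro n
      induction n with
      | zero => exact ⟨h, hh, by simp, by simp⟩
      | succ n ih =>
        obtain ⟨k, hk1, hk2, hk3⟩ := ih
        refine ⟨k * k, by rw [star_mul, hk1], ?_, ?_⟩
        · have h1 : ρ.π (k * k) = star (ρ.π k) * ρ.π k := by rw [map_mul, ← map_star, hk1]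
          rw [h1, CStarRing.norm_star_mul_self, hk2, pow_succ 2 n, pow_mul]; ring
        · refine (toReal_iNorm_mul_le k k).trans ?_
          rw [pow_succ 2 n, pow_mul, sq]
          gcongr
    by_contra hlt
    push Not at hlt
    set a := ‖ρ.π h‖
    set b := (iNorm h).toReal with hb
    have hb0 : 0 ≤ b := ENNReal.toReal_nonneg
    have hle : ∀ n : ℕ, a ^ (2 ^ n) ≤ C * b ^ (2 ^ n) := fun n => by
      obtain ⟨k, -, hk2, hk3⟩ := key n
      rw [← hk2]
      exact (hC' k).trans (by gcongr)
    rcases hb0.eq_or_lt with h0 | hpos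
    · have := hle 0
      simp only [pow_zero, pow_one, ← h0, mul_zero] at this
      linarith
    · have hr : 1 < a / b := (one_lt_div hpos).2 hlt
      have ht : Filter.Tendsto (fun n : ℕ => (a / b) ^ (2 ^ n)) Filter.atTop Filter.atTop :=
        (tendsto_pow_atTop_atTop_of_one_lt hr).comp
          (tendsto_pow_atTop_atTop_of_one_lt one_lt_two)
      obtain ⟨n, hn⟩ := (ht.eventually_gt_atTop (C : ℝ)).exists
      have h1 := hle n
      rw [div_pow, lt_div_iff₀ (by positivity)] at hn
      linarith
  have h1 : ‖ρ.π f‖ * ‖ρ.π f‖ ≤ (iNorm f).toReal * (iNorm f).toReal := by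
    rw [← CStarRing.norm_star_mul_self, ← map_star, ← map_mul]
    refine (hstar _ (by rw [star_mul, star_star])).trans ((toReal_iNorm_mul_le _ _).trans ?_)
    gcongr
    · exact (iNorm_lt_top f).ne
    · exact iNorm_star_le f
  exact abs_le_of_sq_le_sq' (by simpa [sq] using h1) ENNReal.toReal_nonneg |>.2

end INormEstimates

section CStarAlgebras

variable {G : Type u} [TopologicalSpace G] [ArrowGroupoid G] [IsEtaleGroupoid G] [T2Space G]

/-- The `ℓ^∞`-product of a family of C⋆-algebras, with the supremum norm. -/
def LinfProd {ι : Type*} (A : ι → Type*) [∀ i, NonUnitalCStarAlgebra (A i)] : Type _ := lp A ∞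

section LinfProd

variable {ι : Type*} {A : ι → Type*} [∀ i, NonUnitalCStarAlgebra (A i)]

instance : NonUnitalCStarAlgebra (LinfProd A) := inferInstanceAs (NonUnitalCStarAlgebra (lp A ∞))

/-- A family of `*`-homomorphisms `φ i` from `C_c(G)` to C⋆-algebras, dominated by the `I`-norm,
as a single `*`-homomorphism to their `ℓ^∞`-product. -/
def jointHom (φ : ∀ i, CcAlg G →⋆ₙₐ[ℂ] A i) (hφ : ∀ i f, ‖φ i f‖ ≤ (iNorm f).toReal) :
    CcAlg G →⋆ₙₐ[ℂ] LinfProd A where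
  toFun f := (⟨fun i => φ i f, memℓp_infty ⟨_, by rintro _ ⟨i, rfl⟩; exact hφ i f⟩⟩ : lp A ∞)
  map_smul' c f := lp.ext (funext fun i => map_smul (φ i) c f)
  map_zero' := lp.ext (funext fun i => map_zero (φ i))
  map_add' f g := lp.ext (funext fun i => map_add (φ i) f g)
  map_mul' f g := lp.ext (funext fun i => map_mul (φ i) f g)
  map_star' f := lp.ext (funext fun i => map_star (φ i) f)

theorem jointHom_norm (φ : ∀ i, CcAlg G →⋆ₙₐ[ℂ] A i)
    (hφ : ∀ i f, ‖φ i f‖ ≤ (iNorm f).toReal) (f : CcAlg G) :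
    ‖jointHom φ hφ f‖ = ⨆ i, ‖φ i f‖ := lp.norm_eq_ciSup (E := A) _

end LinfProd

/-- The closure of the range of a `*`-homomorphism into a C⋆-algebra: a C⋆-algebra, which is the
completion of `B` for the seminorm `‖φ b‖`. -/
def RangeClosure {B A : Type*} [NonUnitalNonAssocSemiring B] [Module ℂ B] [Star B]
    [NonUnitalCStarAlgebra A] (φ : B →⋆ₙₐ[ℂ] A) : Type _ :=
  (NonUnitalStarAlgHom.range φ).topologicalClosure

section RangeClosure

variable {B A : Type*} [NonUnitalNonAssocSemiring B] [Module ℂ B] [Star B] [NonUnitalCStarAlgebra A]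

instance (φ : B →⋆ₙₐ[ℂ] A) : NonUnitalCStarAlgebra (RangeClosure φ) :=
  NonUnitalStarSubalgebra.nonUnitalCStarAlgebra (NonUnitalStarAlgHom.range φ).topologicalClosure
    (h_closed := NonUnitalStarSubalgebra.isClosed_topologicalClosure _)

/-- The canonical map to the completion. -/
def toRangeClosure (φ : B →⋆ₙₐ[ℂ] A) : B →⋆ₙₐ[ℂ] RangeClosure φ :=
  NonUnitalStarAlgHom.codRestrict φ (NonUnitalStarAlgHom.range φ).topologicalClosure
    fun f => NonUnitalStarSubalgebra.le_topologicalClosure _ ⟨f, rfl⟩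

theorem toRangeClosure_norm (φ : B →⋆ₙₐ[ℂ] A) (b : B) : ‖toRangeClosure φ b‖ = ‖φ b‖ := rfl

theorem toRangeClosure_denseRange (φ : B →⋆ₙₐ[ℂ] A) : DenseRange (toRangeClosure φ) := by
  intro x
  obtain ⟨x, hx⟩ := x
  refine closure_subtype.2 (closure_mono ?_ (show x ∈ closure (Set.range φ) from hx))
  rintro _ ⟨f, rfl⟩
  exact ⟨_, ⟨f, rfl⟩, rfl⟩

/-- The image in a C⋆-algebra `A` of a linear subspace of `B`. -/
def imageIn (φ : B →⋆ₙₐ[ℂ] A) (S : Submodule ℂ B) : Submodule ℂ A :=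
  S.map (φ : B →ₗ[ℂ] A)

/-- Ideals of a C⋆-algebra: closed two-sided ideals. -/
structure IsClosedIdeal (I : Submodule ℂ A) : Prop where
  isClosed : IsClosed (I : Set A)
  mul_mem_left : ∀ a x : A, x ∈ I → a * x ∈ I
  mul_mem_right : ∀ a x : A, x ∈ I → x * a ∈ I

/-- Every nonzero (closed, two-sided) ideal `I` of the C⋆-algebra `A` satisfies `I ∩ D ≠ {0}`. -/
def EveryNonzeroIdealMeets (D : Submodule ℂ A) : Prop :=
  ∀ I : Submodule ℂ A, IsClosedIdeal I → I ≠ ⊥ → I ⊓ D ≠ ⊥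

end RangeClosure

/-- All `I`-norm-bounded `*`-representations of `C_c(G)` together; the norm of the image of `f` is
the full norm `sup {‖π f‖ : π an I-norm-bounded *-representation}`. -/
def fullHom (G : Type u) [TopologicalSpace G] [ArrowGroupoid G] [IsEtaleGroupoid G] [T2Space G] :
    CcAlg G →⋆ₙₐ[ℂ] LinfProd fun ρ : BddRep G => ρ.H →L[ℂ] ρ.H :=
  jointHom (fun ρ : BddRep G => ρ.π) BddRep.norm_le

/-- All regular representations of `C_c(G)` together; the norm of the image of `f` is the reduced
norm `‖f‖_r = sup_u ‖Ind_u f‖`. -/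
def reducedHom (G : Type u) [TopologicalSpace G] [ArrowGroupoid G] [IsEtaleGroupoid G] [T2Space G] :
    CcAlg G →⋆ₙₐ[ℂ] LinfProd fun v : units G => Ell2 (SrcFibre v) →L[ℂ] Ell2 (SrcFibre v) :=
  jointHom regRep regRep_norm_le

/-- The full C⋆-algebra `C*(G)`: the completion of `C_c(G)` in the full norm, realized as the closure
of `C_c(G)` in the product of the algebras `B(H_π)` over all `I`-norm-bounded representations `π`. -/
abbrev FullCStar (G : Type u) [TopologicalSpace G] [ArrowGroupoid G] [IsEtaleGroupoid G]
    [T2Space G] : Type (u + 1) :=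
  RangeClosure (fullHom G)

/-- The reduced C⋆-algebra `C*_r(G)`: the completion of `C_c(G)` in the reduced norm, realized as the
closure of `C_c(G)` in the product over the units `u` of the algebras `B(ℓ²(G_u))`. -/
abbrev ReducedCStar (G : Type u) [TopologicalSpace G] [ArrowGroupoid G] [IsEtaleGroupoid G]
    [T2Space G] : Type u :=
  RangeClosure (reducedHom G)

/-- The canonical map `C_c(G) → C*(G)`. -/
def toFull (G : Type u) [TopologicalSpace G] [ArrowGroupoid G] [IsEtaleGroupoid G]
    [T2Space G] : CcAlg G →⋆ₙₐ[ℂ] FullCStar G :=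
  toRangeClosure (fullHom G)

/-- The canonical map `C_c(G) → C*_r(G)`. -/
def toReduced (G : Type u) [TopologicalSpace G] [ArrowGroupoid G] [IsEtaleGroupoid G]
    [T2Space G] : CcAlg G →⋆ₙₐ[ℂ] ReducedCStar G :=
  toRangeClosure (reducedHom G)

theorem toFull_norm (f : CcAlg G) : ‖toFull G f‖ = ⨆ ρ : BddRep G, ‖ρ.π f‖ :=
  (toRangeClosure_norm (fullHom G) f).trans
    (jointHom_norm (fun ρ : BddRep G => ρ.π) BddRep.norm_le f)

theorem toReduced_norm (f : CcAlg G) : ‖toReduced G f‖ = ⨆ v : units G, ‖regRep v f‖ :=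
  (toRangeClosure_norm (reducedHom G) f).trans (jointHom_norm regRep regRep_norm_le f)

theorem toFull_denseRange : DenseRange (toFull G) := toRangeClosure_denseRange (fullHom G)

theorem toReduced_denseRange : DenseRange (toReduced G) := toRangeClosure_denseRange (reducedHom G)

/-- `C_c(G⁽⁰⁾)`, regarded as the functions in `C_c(G)` that vanish off the (open and closed) subset
`G⁽⁰⁾`. -/
def ccUnits (G : Type u) [TopologicalSpace G] [ArrowGroupoid G] : Submodule ℂ (CcAlg G) where
  carrier := {f | ∀ γ, γ ∉ units G → f γ = 0}
  add_mem' hf hg γ hγ := by simp [hf γ hγ, hg γ hγ]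
  zero_mem' := by simp
  smul_mem' c f hf γ hγ := by simp [hf γ hγ]

theorem iNorm_le_of_mem_ccUnits {f : CcAlg G} (hf : f ∈ ccUnits G) :
    iNorm f ≤ ⨆ γ, ‖f γ‖ₑ := by
  refine iSup_le fun v => max_le ?_ ?_
  · rw [tsum_eq_single ⟨v, src_eq_of_mem v.2⟩ fun γ hγ => ?_]
    · exact le_iSup (fun γ => ‖f γ‖ₑ) _
    · rw [hf γ fun h => hγ (Subtype.ext ((src_eq_of_mem h).symm.trans γ.2)), enorm_zero]
  · rw [tsum_eq_single ⟨v, mem_units_iff.1 v.2⟩ fun γ hγ => ?_]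
    · exact le_iSup (fun γ => ‖f γ‖ₑ) _
    · rw [hf γ fun h => hγ (Subtype.ext ((mem_units_iff.1 h).symm.trans γ.2)), enorm_zero]

/-- The regular representations are `I`-norm-bounded. -/
def regBdd (v : units G) : BddRep G where
  H := Ell2 (SrcFibre v)
  π := regRep v
  bounded := ⟨1, fun f => by
    have h := ENNReal.ofReal_le_ofReal (regRep_norm_le v f)
    rwa [ofReal_norm, ENNReal.ofReal_toReal (iNorm_lt_top f).ne, ← one_mul (iNorm f)] at h⟩

/-- On `C_c(G⁽⁰⁾)` the full norm is the supremum norm. -/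
theorem toFull_enorm_of_mem_ccUnits {f : CcAlg G} (hf : f ∈ ccUnits G) :
    ‖toFull G f‖ₑ = ⨆ γ, ‖f γ‖ₑ := by
  have hle : ∀ ρ : BddRep G, ‖ρ.π f‖ ≤ ‖toFull G f‖ := fun ρ => by
    rw [toFull_norm]
    exact le_ciSup (f := fun ρ : BddRep G => ‖ρ.π f‖)
      ⟨_, by rintro _ ⟨σ, rfl⟩; exact σ.norm_le f⟩ ρ
  refine le_antisymm ?_ (iSup_le fun γ => ?_)
  · refine le_trans ?_ (iNorm_le_of_mem_ccUnits hf)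
    rw [← ofReal_norm, ← ENNReal.ofReal_toReal (iNorm_lt_top f).ne, toFull_norm]
    exact ENNReal.ofReal_le_ofReal
      (Real.iSup_le (fun ρ => ρ.norm_le f) ENNReal.toReal_nonneg)
  · by_cases hγ : γ ∈ units G
    · have hs := src_eq_of_mem hγ
      let γ' : SrcFibre (⟨γ, hγ⟩ : units G) := ⟨γ, hs⟩
      have h1 : regRep ⟨γ, hγ⟩ f (delta γ') γ' = f γ := by
        refine (regOp_delta _ f γ' γ').trans ?_
        rw [comp_inv, mem_units_iff.1 hγ]
      have h2 : ‖f γ‖ ≤ ‖regRep ⟨γ, hγ⟩ f‖ := by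
        classical
        rw [← h1]
        refine (lp.norm_apply_le_norm (by norm_num) _ _).trans
          ((ContinuousLinearMap.le_opNorm _ _).trans_eq ?_)
        simp [delta, lp.norm_single]
      rw [← ofReal_norm, ← ofReal_norm]
      exact ENNReal.ofReal_le_ofReal (h2.trans (hle (regBdd ⟨γ, hγ⟩)))
    · simp [hf γ hγ]

/-- The copy of `C_c(G⁽⁰⁾)` in the reduced C⋆-algebra. -/
def ccUnitsReduced (G : Type u) [TopologicalSpace G] [ArrowGroupoid G] [IsEtaleGroupoid G]
    [T2Space G] : Submodule ℂ (ReducedCStar G) :=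
  imageIn (toReduced G) (ccUnits G)

/-- The copy of `C_0(G⁽⁰⁾)` in the full C⋆-algebra: the closure of `C_c(G⁽⁰⁾)`, on which the norm of
`C*(G)` is the supremum norm. -/
def c0UnitsFull (G : Type u) [TopologicalSpace G] [ArrowGroupoid G] [IsEtaleGroupoid G]
    [T2Space G] : Submodule ℂ (FullCStar G) :=
  (imageIn (toFull G) (ccUnits G)).topologicalClosure

end CStarAlgebras

end ArrowGroupoid

end

/-! Part 2 is proved by contraposition. If some nonempty open set of units has nontrivial isotropy
throughout, Baire's theorem yields a nonempty open set `B` of non-unit isotropy elements on which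
the source map is injective (`exists_isotropic_bisection`). For a bump function `φ` supported in
`B`, the pointwise square `|φ|²` lives on `B`, while the convolution `φ* * φ` lives on the units.
The representation on `ℓ²(G⁽⁰⁾)` by `δ_{s γ} ↦ δ_{r γ}` sees only the range and source of an arrow,
so it cannot tell these two functions apart (`orbitOp_normSq`), and its kernel in `C*(G)` is a
nonzero ideal. On `C_0(G⁽⁰⁾)` the same representation acts by diagonal matrices and is isometric
(`norm_le_coordHom_orbitRep`), so the kernel meets `C_0(G⁽⁰⁾)` only in zero.

For part 1, the diagonal coefficients of `Ind_u(f)` are values of `f` at units; they play the role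
of the faithful conditional expectation. A nonzero ideal `I` contains `c = a* a` with a nonzero
diagonal coefficient. Approximate `c` by `b` in `C_c(G)`; then `b` is large at some unit, hence on
an open set of units, hence at a unit `v` with trivial isotropy. Multiplying on both sides by a bump
`h` concentrated near `v` removes everything off the unit space (`exists_open_compress`), so `k = h
b h` lies in `C_c(G⁽⁰⁾)`, close to `h c h` in `I` and large at `v`. A cut-off of `k` then lies in
`I` itself, by an approximate division argument (`inf_ccUnitsReduced_ne_bot`,
`IsClosedIdeal.mem_of_sub_mul_mem`). -/

namespace ArrowGroupoid

/-! ### Matrix coefficients, bump functions and pointwise operations on `C_c(G)`. -/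

section Preliminaries

theorem summable_of_tsum_enorm_lt_top {ι : Type*} {f : ι → ℂ} (h : ∑' i, ‖f i‖ₑ < ⊤) :
    Summable f := by
  refine Summable.of_norm ?_
  have : Summable fun j => ‖f j‖₊ := ENNReal.tsum_coe_ne_top_iff_summable.1 h.ne
  exact NNReal.summable_coe.2 this

theorem norm_delta_coeff_le {ι : Type u} (T : Ell2 ι →L[ℂ] Ell2 ι) (i j : ι) :
    ‖T (delta j) i‖ ≤ ‖T‖ := by
  classical
  refine (lp.norm_apply_le_norm (by norm_num) _ _).trans
    ((ContinuousLinearMap.le_opNorm _ _).trans_eq ?_)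
  simp [delta, lp.norm_single]

variable {G : Type u} [TopologicalSpace G]

/-- A bump function at a point of an open set. -/
theorem exists_bump [T2Space G] [LocallyCompactSpace G] {U : Set G} (hU : IsOpen U) {x : G}
    (hx : x ∈ U) :
    ∃ f : CcAlg G, f x = 1 ∧ (∀ γ ∉ U, f γ = 0) ∧ ∀ γ, ‖f γ‖ ≤ 1 := by
  obtain ⟨f, h1, h2, h3, h4⟩ := exists_continuous_one_zero_of_isCompact (isCompact_singleton (x := x))
    hU.isClosed_compl (Set.disjoint_singleton_left.2 fun h => h hx)
  refine ⟨⟨⟨fun γ => (f γ : ℂ), Complex.continuous_ofReal.comp f.continuous⟩,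
    h3.comp_left Complex.ofReal_zero⟩, ?_, fun γ hγ => ?_, fun γ => ?_⟩
  · change ((f x : ℝ) : ℂ) = 1
    rw [h1 rfl]; simp
  · change ((f γ : ℝ) : ℂ) = 0
    rw [h2 hγ]; simp
  · change ‖((f γ : ℝ) : ℂ)‖ ≤ 1
    rw [Complex.norm_real, Real.norm_of_nonneg (h4 γ).1]
    exact (h4 γ).2

/-- The pointwise square `|φ|²`. -/
def CcAlg.normSq (φ : CcAlg G) : CcAlg G :=
  ⟨⟨fun γ => star (φ γ) * φ γ, φ.continuous.star.mul φ.continuous⟩,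
    HasCompactSupport.mul_left (f := fun γ => star (φ γ)) φ.hasCompactSupport⟩

theorem CcAlg.normSq_apply (φ : CcAlg G) (γ : G) : φ.normSq γ = star (φ γ) * φ γ := rfl

/-- Composition with a continuous function vanishing at `0`. -/
noncomputable def CcAlg.map (F : C(ℂ, ℂ)) (hF : F 0 = 0) (f : CcAlg G) : CcAlg G :=
  ⟨⟨fun γ => F (f γ), F.continuous.comp f.continuous⟩, f.hasCompactSupport.comp_left hF⟩

theorem CcAlg.map_apply (F : C(ℂ, ℂ)) (hF : F 0 = 0) (f : CcAlg G) (γ : G) :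
    f.map F hF γ = F (f γ) := rfl

end Preliminaries

/-! ### Topology of the unit space. -/

section UnitSpace

variable {G : Type u} [TopologicalSpace G] [ArrowGroupoid G] [IsEtaleGroupoid G]

/-- An arrow `γ` and the unit `s γ` have the same source. Near a unit both lie in a set where the
source map is injective, so they coincide. -/
theorem isOpen_units : IsOpen (units G) := by
  refine isOpen_iff_mem_nhds.2 fun u hu => ?_
  obtain ⟨e, he, hes⟩ := IsEtaleGroupoid.isLocalHomeomorph_src (G := G) u
  have hs : src u = u := src_eq_of_mem hu
  have hc : Continuous (src : G → G) := IsTopologicalGroupoid.continuous_src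
  have h1 : ∀ᶠ γ in 𝓝 u, γ ∈ e.source := e.open_source.mem_nhds he
  have h2 : ∀ᶠ γ in 𝓝 u, src γ ∈ e.source :=
    hc.continuousAt.eventually (by rw [hs]; exact h1)
  filter_upwards [h1, h2] with γ hγ hγ'
  have : γ = src γ := e.injOn hγ hγ' (by rw [← hes]; exact Subtype.ext (src_src γ).symm)
  rw [this]
  exact src_mem γ

theorem isClosed_units [T2Space G] : IsClosed (units G) := by
  have : units G = {γ : G | rng γ = γ} := Set.ext fun γ => mem_units_iff
  rw [this]
  exact isClosed_eq IsTopologicalGroupoid.continuous_rng continuous_id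

end UnitSpace

/-! ### The representation of `C_c(G)` on `ℓ²(G⁽⁰⁾)`. -/

section OrbitRepresentation

section Fibres

variable {G : Type u} [ArrowGroupoid G]

/-- The range fibre over `w`, partitioned by source. -/
def rngFibreEquiv (w : G) :
    (Σ v : units G, {γ : G // rng γ = w ∧ src γ = v}) ≃ {γ : G // rng γ = w} where
  toFun x := ⟨x.2.1, x.2.2.1⟩
  invFun γ := ⟨srcU γ.1, γ.1, γ.2, rfl⟩
  left_inv := by
    rintro ⟨⟨v, hv⟩, γ, h1, h2⟩
    dsimp only at h2
    subst h2
    rfl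
  right_inv _ := rfl

/-- The source fibre over `v`, partitioned by range. -/
def srcFibreEquiv (v : G) :
    (Σ w : units G, {γ : G // rng γ = w ∧ src γ = v}) ≃ {γ : G // src γ = v} where
  toFun x := ⟨x.2.1, x.2.2.2⟩
  invFun γ := ⟨rngU γ.1, γ.1, rfl, γ.2⟩
  left_inv := by
    rintro ⟨⟨w, hw⟩, γ, h1, h2⟩
    dsimp only at h1
    subst h1
    rfl
  right_inv _ := rfl

/-- Inversion exchanges the arrows from `v` to `w` with those from `w` to `v`. -/
def invHomEquiv (w v : G) :
    {γ : G // rng γ = w ∧ src γ = v} ≃ {γ : G // rng γ = v ∧ src γ = w} where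
  toFun γ := ⟨inv γ.1, by simp [γ.2]⟩
  invFun γ := ⟨inv γ.1, by simp [γ.2]⟩
  left_inv γ := by simp
  right_inv γ := by simp

/-- The matrix entry `∑ f(γ)` over the arrows `γ` from `v` to `w`. -/
noncomputable def orbitKernel (f : G → ℂ) (w v : units G) : ℂ :=
  ∑' γ : {γ : G // rng γ = w ∧ src γ = v}, f γ

/-- Regrouping a range fibre by source bounds each row sum by a fibre sum of `f`. With the analogous
column bound this is the input to Schur's test for `orbitOp`. -/
theorem orbitKernel_rows_le (f : G → ℂ) (w : units G) :
    ∑' v, ‖orbitKernel f w v‖ₑ ≤ iNorm f := by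
  calc ∑' v, ‖orbitKernel f w v‖ₑ
      ≤ ∑' (v : units G) (γ : {γ : G // rng γ = w ∧ src γ = v}), ‖f γ‖ₑ :=
        ENNReal.tsum_le_tsum fun v => enorm_tsum_le_tsum_enorm
    _ = ∑' γ : {γ : G // rng γ = w}, ‖f γ‖ₑ := by
        rw [← ENNReal.tsum_sigma, ← (rngFibreEquiv (w : G)).tsum_eq]
        rfl
    _ ≤ iNorm f := tsum_rng_le_iNorm f w.2

theorem orbitKernel_cols_le (f : G → ℂ) (v : units G) :
    ∑' w, ‖orbitKernel f w v‖ₑ ≤ iNorm f := by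
  calc ∑' w, ‖orbitKernel f w v‖ₑ
      ≤ ∑' (w : units G) (γ : {γ : G // rng γ = w ∧ src γ = v}), ‖f γ‖ₑ :=
        ENNReal.tsum_le_tsum fun v => enorm_tsum_le_tsum_enorm
    _ = ∑' γ : {γ : G // src γ = v}, ‖f γ‖ₑ := by
        rw [← ENNReal.tsum_sigma, ← (srcFibreEquiv (v : G)).tsum_eq]
        rfl
    _ ≤ iNorm f := tsum_src_le_iNorm f v.2

theorem norm_apply_srcU_le (ξ : Ell2 (units G)) (γ : G) : ‖ξ (srcU γ)‖ ≤ ‖ξ‖ :=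
  lp.norm_apply_le_norm (by norm_num) ξ _

theorem orbitKernel_of_mem_ccUnits [TopologicalSpace G] {f : CcAlg G} (hf : f ∈ ccUnits G) (u : units G) :
    orbitKernel f u u = f u := by
  rw [orbitKernel, tsum_eq_single ⟨(u : G), mem_units_iff.1 u.2, src_eq_of_mem u.2⟩]
  rintro ⟨γ, h1, h2⟩ hγ
  refine hf γ fun h => hγ (Subtype.ext ?_)
  exact (src_eq_of_mem h).symm.trans h2

end Fibres

variable {G : Type u} [TopologicalSpace G] [ArrowGroupoid G] [IsEtaleGroupoid G] [T2Space G]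

theorem summable_rng_mul (f : CcAlg G) (w : units G) {ξ : G → ℂ} {C : ℝ} (hξ : ∀ γ, ‖ξ γ‖ ≤ C) :
    Summable fun γ : {γ : G // rng γ = w} => f γ * ξ γ := by
  have h : Summable fun γ : {γ : G // rng γ = w} => ‖f γ‖ := (summable_of_tsum_enorm_lt_top
    ((tsum_rng_le_iNorm f w.2).trans_lt (iNorm_lt_top f))).norm
  refine Summable.of_norm_bounded (h.mul_right C) fun γ => ?_
  rw [norm_mul]
  gcongr
  exact hξ _

/-- The operator `(T_f ξ)(w) = ∑_{r γ = w} f(γ) ξ(s γ)` on `ℓ²(G⁽⁰⁾)`. -/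
noncomputable def orbitOp (f : CcAlg G) : Ell2 (units G) →L[ℂ] Ell2 (units G) :=
  schurOp (orbitKernel f) (iNorm f).toNNReal
    (fun w => (orbitKernel_rows_le f w).trans_eq (coe_toNNReal_iNorm f).symm)
    (fun v => (orbitKernel_cols_le f v).trans_eq (coe_toNNReal_iNorm f).symm)

theorem orbitOp_delta (f : CcAlg G) (w v : units G) :
    orbitOp f (delta v) w = orbitKernel f w v := schurOp_delta _ _ _ _ _ _

/-- The matrix form of `orbitOp` gives boundedness and adjoints; this form, a single sum over a
range fibre, is the one suited to convolution products. -/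
theorem orbitOp_apply (f : CcAlg G) (ξ : Ell2 (units G)) (w : units G) :
    orbitOp f ξ w = ∑' γ : {γ : G // rng γ = w}, f γ * ξ (srcU γ.1) := by
  have hs := summable_rng_mul f w (norm_apply_srcU_le ξ)
  rw [← (rngFibreEquiv (w : G)).summable_iff] at hs
  have hs' : Summable fun x : (Σ v : units G, {γ : G // rng γ = w ∧ src γ = v}) =>
      f x.2 * ξ x.1 := by
    refine hs.congr fun x => ?_
    have : srcU x.2.1 = x.1 := Subtype.ext x.2.2.2
    simp [rngFibreEquiv, this]
  rw [orbitOp, schurOp_apply]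
  simp_rw [orbitKernel, ← tsum_mul_right]
  rw [← hs'.tsum_sigma, ← (rngFibreEquiv (w : G)).tsum_eq]
  refine tsum_congr fun x => ?_
  have : srcU x.2.1 = x.1 := Subtype.ext x.2.2.2
  simp [rngFibreEquiv, this]

theorem orbitOp_add (f g : CcAlg G) : orbitOp (f + g) = orbitOp f + orbitOp g := by
  refine ContinuousLinearMap.ext fun ξ => lp.ext (funext fun w => ?_)
  have h := (summable_rng_mul f w (norm_apply_srcU_le ξ)).tsum_add
    (summable_rng_mul g w (norm_apply_srcU_le ξ))
  rw [← orbitOp_apply, ← orbitOp_apply] at h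
  refine Eq.trans ?_ h
  rw [orbitOp_apply]
  exact tsum_congr fun γ => add_mul _ _ _

theorem orbitOp_smul (c : ℂ) (f : CcAlg G) : orbitOp (c • f) = c • orbitOp f := by
  refine ContinuousLinearMap.ext fun ξ => lp.ext (funext fun w => ?_)
  simp only [smul_apply, lp.coeFn_smul, Pi.smul_apply, orbitOp_apply,
    CcAlg.smul_apply, mul_assoc, smul_eq_mul, tsum_mul_left]

theorem orbitOp_mul (f g : CcAlg G) : orbitOp (f * g) = orbitOp f * orbitOp g := by
  refine ContinuousLinearMap.ext fun ξ => lp.ext (funext fun w => ?_)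
  let F : {γ : G // rng γ = w} → {α : G // rng α = w} → ℂ :=
    fun γ α => f α * (g (inv α.1 ⋄ γ.1) * ξ (srcU γ.1))
  -- Absolute summability, with bound `‖f‖_I ‖g‖_I ‖ξ‖`, licenses exchanging the two sums; the
  -- substitution `β = α⁻¹ γ` then separates `f` from `g`.
  have hF : Summable (Function.uncurry F) := by
    refine summable_of_tsum_enorm_lt_top (lt_of_le_of_lt ?_
      (ENNReal.mul_lt_top (iNorm_lt_top f) (ENNReal.mul_lt_top (iNorm_lt_top g)
        (enorm_lt_top (x := ξ)))))
    rw [ENNReal.tsum_prod', ENNReal.tsum_comm]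
    calc ∑' (α : {α : G // rng α = w}) (γ : {γ : G // rng γ = w}), ‖F γ α‖ₑ
        ≤ ∑' (α : {α : G // rng α = w}) (γ : {γ : G // rng γ = w}),
            ‖f α‖ₑ * (‖g (inv α.1 ⋄ γ.1)‖ₑ * ‖ξ‖ₑ) := by
          refine ENNReal.tsum_le_tsum fun α => ENNReal.tsum_le_tsum fun γ => ?_
          simp only [F, enorm_mul]
          gcongr
          exact enorm_le_iff_norm_le.2 (norm_apply_srcU_le ξ γ)
      _ ≤ ∑' α : {α : G // rng α = w}, ‖f α‖ₑ * (iNorm g * ‖ξ‖ₑ) := by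
          refine ENNReal.tsum_le_tsum fun α => ?_
          rw [ENNReal.tsum_mul_left, ENNReal.tsum_mul_right]
          gcongr
          obtain ⟨α, hα⟩ := α
          obtain rfl : w = ⟨rng α, rng_mem α⟩ := Subtype.ext hα.symm
          exact le_of_eq_of_le ((leftEquiv α).tsum_eq fun β => ‖g β‖ₑ)
            (tsum_rng_le_iNorm g (src_mem α))
      _ ≤ _ := by
          rw [ENNReal.tsum_mul_right]
          gcongr
          exact tsum_rng_le_iNorm f w.2
  calc orbitOp (f * g) ξ w = ∑' (γ : {γ : G // rng γ = w}) (α : {α : G // rng α = w}), F γ α := by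
        rw [orbitOp_apply]
        refine tsum_congr fun γ => ?_
        obtain ⟨γ, hγ⟩ := γ
        obtain rfl : w = ⟨rng γ, rng_mem γ⟩ := Subtype.ext hγ.symm
        rw [CcAlg.mul_apply, ← tsum_mul_right]
        simp_rw [mul_assoc]
        rfl
    _ = ∑' (α : {α : G // rng α = w}) (γ : {γ : G // rng γ = w}), F γ α := hF.tsum_comm.symm
    _ = (orbitOp f * orbitOp g) ξ w := by
        rw [mul_apply_eq_comp, orbitOp_apply]
        refine tsum_congr fun α => ?_
        rw [tsum_mul_left, orbitOp_apply]
        congr 1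
        obtain ⟨α, hα⟩ := α
        obtain rfl : w = ⟨rng α, rng_mem α⟩ := Subtype.ext hα.symm
        refine Eq.trans (tsum_congr fun γ => ?_)
          ((leftEquiv α).tsum_eq fun β => g β * ξ (srcU β.1))
        have : srcU (inv α ⋄ γ.1) = srcU γ.1 :=
          Subtype.ext (src_comp _ _ (by simp [γ.2]))
        simp [leftEquiv, this]

theorem orbitOp_star (f : CcAlg G) : orbitOp (star f) = star (orbitOp f) := by
  refine ell2_op_ext fun w v => ?_
  rw [adjoint_delta, orbitOp_delta, orbitOp_delta, orbitKernel, orbitKernel,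
    ← (invHomEquiv (w : G) v).tsum_eq, tsum_star]
  rfl

theorem orbitOp_zero : orbitOp (0 : CcAlg G) = 0 := by
  simpa using orbitOp_smul (0 : ℂ) (0 : CcAlg G)

/-- The representation of `C_c(G)` on `ℓ²(G⁽⁰⁾)`, the direct sum of those on the orbits. -/
noncomputable def orbitRep (G : Type u) [TopologicalSpace G] [ArrowGroupoid G] [IsEtaleGroupoid G]
    [T2Space G] : BddRep G where
  H := Ell2 (units G)
  π :=
    { toFun := orbitOp
      map_smul' := orbitOp_smul
      map_zero' := orbitOp_zero
      map_add' := orbitOp_add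
      map_mul' := orbitOp_mul
      map_star' := orbitOp_star }
  bounded := ⟨1, fun f => by
    have h : ‖orbitOp f‖ ≤ (iNorm f).toReal := schurOp_norm_le _ _ _ _
    have h' := ENNReal.ofReal_le_ofReal h
    rwa [ofReal_norm, ENNReal.ofReal_toReal (iNorm_lt_top f).ne, ← one_mul (iNorm f)] at h'⟩

theorem norm_apply_le_norm_orbitOp {f : CcAlg G} (hf : f ∈ ccUnits G) (u : units G) :
    ‖f u‖ ≤ ‖orbitOp f‖ := by
  rw [← orbitKernel_of_mem_ccUnits hf u, ← orbitOp_delta]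
  exact norm_delta_coeff_le _ _ _

/-- The values of `f` at units are diagonal entries of `orbitOp f`, and the full norm of such an `f`
is its supremum norm. -/
theorem toFull_norm_le_orbitOp {f : CcAlg G} (hf : f ∈ ccUnits G) :
    ‖toFull G f‖ ≤ ‖orbitOp f‖ := by
  rw [← enorm_le_iff_norm_le, toFull_enorm_of_mem_ccUnits hf]
  refine iSup_le fun γ => ?_
  by_cases hγ : γ ∈ units G
  · exact enorm_le_iff_norm_le.2 (norm_apply_le_norm_orbitOp hf ⟨γ, hγ⟩)
  · simp [hf γ hγ]

end OrbitRepresentation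

/-! ### Coordinate homomorphisms of a completion inside an `ℓ^∞`-product, and their kernels. -/

section Coordinates

variable {B : Type*} [NonUnitalNonAssocSemiring B] [Module ℂ B] [Star B]
  {ι : Type*} {A : ι → Type*} [∀ i, NonUnitalCStarAlgebra (A i)]

/-- Evaluation at a coordinate of the `ℓ^∞`-product. -/
def LinfProd.eval (i : ι) : LinfProd A →⋆ₙₐ[ℂ] A i where
  toFun a := let b : lp A ∞ := a; b i
  map_smul' _ _ := rfl
  map_zero' := rfl
  map_add' _ _ := rfl
  map_mul' _ _ := rfl
  map_star' _ := rfl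

variable {Φ : B →⋆ₙₐ[ℂ] LinfProd A}

/-- The `i`-th coordinate, on the closure of the range of a `*`-homomorphism to an
`ℓ^∞`-product. -/
noncomputable def coordHom (i : ι) : RangeClosure Φ →⋆ₙₐ[ℂ] A i where
  toFun a := LinfProd.eval i a.1
  map_smul' _ _ := rfl
  map_zero' := rfl
  map_add' _ _ := rfl
  map_mul' _ _ := rfl
  map_star' _ := rfl

theorem eq_zero_of_coordHom_eq_zero {a : RangeClosure Φ} (h : ∀ i, coordHom i a = 0) : a = 0 :=
  Subtype.ext (lp.ext (E := A) (p := ∞) (funext h))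

theorem norm_coordHom_le (i : ι) (a : RangeClosure Φ) : ‖coordHom i a‖ ≤ ‖a‖ :=
  lp.norm_apply_le_norm (E := A) (p := ∞) ENNReal.top_ne_zero a.1 i

theorem continuous_coordHom (i : ι) : Continuous (coordHom i : RangeClosure Φ → A i) :=
  AddMonoidHomClass.continuous_of_bound (coordHom i) 1
    fun a => (norm_coordHom_le i a).trans_eq (one_mul _).symm

variable (Φ) in
/-- The kernel of the `i`-th coordinate. -/
noncomputable def coordKer (i : ι) : Submodule ℂ (RangeClosure Φ) :=
  LinearMap.ker ((coordHom i : RangeClosure Φ →⋆ₙₐ[ℂ] A i) : RangeClosure Φ →ₗ[ℂ] A i)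

theorem mem_coordKer {i : ι} {a : RangeClosure Φ} : a ∈ coordKer Φ i ↔ coordHom i a = 0 := Iff.rfl

theorem isClosedIdeal_coordKer (i : ι) : IsClosedIdeal (coordKer Φ i) where
  isClosed := isClosed_singleton.preimage (continuous_coordHom i)
  mul_mem_left a x hx := by rw [mem_coordKer] at hx ⊢; rw [map_mul, hx, mul_zero]
  mul_mem_right a x hx := by rw [mem_coordKer] at hx ⊢; rw [map_mul, hx, zero_mul]

end Coordinates

/-! ### Open bisections of nontrivial isotropy, by Baire's theorem. -/

section Bisections

variable {G : Type u} [TopologicalSpace G] [ArrowGroupoid G]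

/-- If every unit in a nonempty open set has nontrivial isotropy, then there is a nonempty open
bisection consisting of nontrivial isotropy elements. -/
theorem exists_isotropic_bisection [IsEtaleGroupoid G] [T2Space G] [LocallyCompactSpace G]
    [SecondCountableTopology G] (h : ¬ IsTopologicallyPrincipal G) :
    ∃ B : Set G, IsOpen B ∧ B.Nonempty ∧ (∀ γ ∈ B, rng γ = src γ) ∧ Set.InjOn src B ∧
      ∀ γ ∈ B, γ ∉ units G := by
  have hcs : Continuous (srcU : G → units G) := IsEtaleGroupoid.isLocalHomeomorph_src.continuous
  obtain ⟨U, hU, hUne, hUd⟩ : ∃ U : Set (units G), IsOpen U ∧ U.Nonempty ∧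
      ∀ u ∈ U, {γ : G | rng γ = u ∧ src γ = u} ≠ {(u : G)} := by
    simp only [IsTopologicallyPrincipal, dense_iff_inter_open, not_forall] at h
    obtain ⟨U, hU, hne, hemp⟩ := h
    exact ⟨U, hU, hne, fun u hu h' => hemp ⟨u, hu, h'⟩⟩
  -- The compact `K` has closed image in the unit space, as Baire's theorem needs; the larger open
  -- `V`, still injective for the source map, makes the final set open.
  have hloc : ∀ γ ∈ (units G)ᶜ, ∃ K V : Set G, IsCompact K ∧ γ ∈ interior K ∧ K ⊆ V ∧
      IsOpen V ∧ Set.InjOn src V ∧ K ⊆ (units G)ᶜ := fun γ hγ => by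
    obtain ⟨e, he, hes⟩ := IsEtaleGroupoid.isLocalHomeomorph_src (G := G) γ
    obtain ⟨K, hK, hγK, hKs⟩ := exists_compact_subset
      (e.open_source.inter isClosed_units.isOpen_compl) ⟨he, hγ⟩
    refine ⟨K, e.source, hK, hγK, hKs.trans Set.inter_subset_left, e.open_source, ?_,
      hKs.trans Set.inter_subset_right⟩
    intro x hx y hy hxy
    exact e.injOn hx hy (by rw [← hes]; exact Subtype.ext hxy)
  choose! K V hK hγK hKV hV hVi hKu using hloc
  obtain ⟨t, htu, htc, ht⟩ := TopologicalSpace.countable_cover_nhdsWithin (s := (units G)ᶜ) (f := K)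
    fun γ hγ => mem_nhdsWithin_of_mem_nhds (mem_interior_iff_mem_nhds.1 (hγK γ hγ))
  have : Countable t := htc.to_subtype
  -- Countably many closed sets covering the unit space: the complement of `U`, and the sources of
  -- the isotropy elements in each `K γ`. They cover because every unit of `U` carries a nontrivial
  -- isotropy element.
  let F : Option t → Set (units G) := fun o =>
    o.elim Uᶜ fun γ => srcU '' (K γ ∩ {x | rng x = src x})
  have hclosed : IsClosed {x : G | rng x = src x} :=
    isClosed_eq IsTopologicalGroupoid.continuous_rng IsTopologicalGroupoid.continuous_src
  have hF : ∀ o, IsClosed (F o) := by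
    rintro (_ | γ)
    · exact hU.isClosed_compl
    · exact (((hK γ (htu γ.2)).inter_right hclosed).image hcs).isClosed
  have hcover : ⋃ o, F o = Set.univ := by
    refine Set.eq_univ_of_forall fun u => Set.mem_iUnion.2 ?_
    by_cases hu : u ∈ U
    · obtain ⟨γ, ⟨hγr, hγs⟩, hγu⟩ : ∃ γ : G, (rng γ = u ∧ src γ = u) ∧ γ ≠ u := by
        by_contra! hcon
        refine hUd u hu (Set.eq_singleton_iff_unique_mem.2 ⟨?_, fun γ hγ => hcon γ hγ⟩)
        exact ⟨mem_units_iff.1 u.2, src_eq_of_mem u.2⟩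
      have hγ : γ ∈ (units G)ᶜ := fun hγ => hγu ((src_eq_of_mem hγ).symm.trans hγs)
      obtain ⟨x, hx, hγx⟩ := Set.mem_iUnion₂.1 (ht hγ)
      exact ⟨some ⟨x, hx⟩, γ, ⟨hγx, hγr.trans hγs.symm⟩, Subtype.ext hγs⟩
    · exact ⟨none, hu⟩
  have : LocallyCompactSpace (units G) := isClosed_units.locallyCompactSpace
  obtain ⟨u, huU, hu⟩ := (dense_iUnion_interior_of_closed hF hcover).inter_open_nonempty U hU hUne
  obtain ⟨_ | γ, hγ⟩ := Set.mem_iUnion.1 hu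
  · exact absurd huU (interior_subset hγ)
  -- Such an `x` shares its source with an isotropy element of `K γ`, and injectivity of the source
  -- map on `V γ` forces the two to be equal.
  have hkey : ∀ x ∈ V γ, srcU x ∈ interior (F (some γ)) → x ∈ K γ ∧ rng x = src x := by
    intro x hx hxs
    obtain ⟨y, hy, hyx⟩ := interior_subset hxs
    have := hVi γ (htu γ.2) (hKV γ (htu γ.2) hy.1) hx (congrArg Subtype.val hyx)
    rwa [← this]
  refine ⟨V γ ∩ srcU ⁻¹' interior (F (some γ)), (hV γ (htu γ.2)).inter
    (isOpen_interior.preimage hcs), ?_, fun x hx => (hkey x hx.1 hx.2).2,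
    (hVi γ (htu γ.2)).mono Set.inter_subset_left, fun x hx => hKu γ (htu γ.2) (hkey x hx.1 hx.2).1⟩
  obtain ⟨y, hy, rfl⟩ := interior_subset hγ
  exact ⟨y, hKV γ (htu γ.2) hy.1, hγ⟩

end Bisections

/-! ### The kernel of the orbit representation in the full algebra. -/

section FullAlgebra

variable {G : Type u} [TopologicalSpace G] [ArrowGroupoid G]

variable [IsEtaleGroupoid G] [T2Space G]

/-- Since `B` is isotropic, both operators are diagonal. Over a unit `w` there is at most one `β ∈
B`, and both diagonal entries equal `|φ(β)|²`, or `0` if there is no such `β`. -/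
theorem orbitOp_normSq {B : Set G} (hiso : ∀ γ ∈ B, rng γ = src γ) (hinj : Set.InjOn src B)
    {φ : CcAlg G} (hφ : ∀ γ ∉ B, φ γ = 0) : orbitOp φ.normSq = orbitOp (star φ * φ) := by
  have hzero : ∀ w v : units G, w ≠ v → orbitKernel φ w v = 0 := fun w v hwv => by
    refine (tsum_congr fun γ => hφ _ fun hγ => hwv (Subtype.ext ?_)).trans tsum_zero
    exact γ.2.1.symm.trans ((hiso _ hγ).trans γ.2.2)
  rw [orbitOp_mul, orbitOp_star]
  refine ell2_op_ext fun w v => ?_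
  have hdiag : orbitOp φ (delta v) = orbitKernel φ v v • delta v := by
    classical
    refine lp.ext (funext fun x => ?_)
    rw [orbitOp_delta]
    by_cases h : x = v
    · subst h; simp [delta]
    · rw [hzero x v h]; simp [delta, h]
  rw [mul_apply_eq_comp, hdiag, map_smul, lp.coeFn_smul, Pi.smul_apply, adjoint_delta,
    orbitOp_delta, orbitOp_delta, smul_eq_mul]
  by_cases h : w = v
  · subst h
    by_cases hB : ∃ β ∈ B, src β = w
    · obtain ⟨β, hβ, hβw⟩ := hB
      have hone : ∀ f : CcAlg G, (∀ γ ∉ B, f γ = 0) → orbitKernel f w w = f β := fun f hf => by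
        refine tsum_eq_single (⟨β, (hiso β hβ).trans hβw, hβw⟩ :
          {γ : G // rng γ = w ∧ src γ = w}) fun γ hγ => hf _ fun hγB => hγ ?_
        exact Subtype.ext (hinj hγB hβ (γ.2.2.trans hβw.symm))
      rw [hone φ hφ, hone φ.normSq fun γ hγ => by rw [CcAlg.normSq_apply, hφ γ hγ, mul_zero],
        CcAlg.normSq_apply, mul_comm]
    · have hnone : ∀ f : CcAlg G, (∀ γ ∉ B, f γ = 0) → orbitKernel f w w = 0 := fun f hf => by
        refine (tsum_congr fun γ => hf _ fun hγB => ?_).trans tsum_zero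
        exact hB ⟨γ, hγB, γ.2.2⟩
      rw [hnone φ hφ, hnone φ.normSq fun γ hγ => by rw [CcAlg.normSq_apply, hφ γ hγ, mul_zero],
        zero_mul]
  · rw [hzero v w (Ne.symm h), star_zero, mul_zero]
    refine (tsum_congr fun γ => ?_).trans tsum_zero
    rw [CcAlg.normSq_apply, hφ _ fun hγ => h (Subtype.ext ?_), mul_zero]
    exact γ.2.1.symm.trans ((hiso _ hγ).trans γ.2.2)

/-- A nonzero term needs `α⁻¹` and `α⁻¹ γ` in `B`. They have the same range, hence the same source,
hence are equal, and then `γ` is a unit. -/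
theorem star_mul_self_apply_of_notMem_units {B : Set G} (hiso : ∀ γ ∈ B, rng γ = src γ)
    (hinj : Set.InjOn src B) {φ : CcAlg G} (hφ : ∀ γ ∉ B, φ γ = 0) {γ : G} (hγ : γ ∉ units G) :
    (star φ * φ) γ = 0 := by
  rw [CcAlg.mul_apply]
  refine (tsum_congr fun α => ?_).trans tsum_zero
  by_contra hne
  have h1 : inv α.1 ∈ B := by
    by_contra h
    exact left_ne_zero_of_mul hne (by rw [CcAlg.star_apply, hφ _ h, star_zero])
  have h2 : inv α.1 ⋄ γ ∈ B := by
    by_contra h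
    exact right_ne_zero_of_mul hne (hφ _ h)
  have hc : src (inv α.1) = rng γ := by simp [α.2]
  have h3 : src (inv α.1) = src (inv α.1 ⋄ γ) := by
    rw [← hiso _ h1, ← hiso _ h2, rng_comp _ _ hc]
  have h4 := hinj h1 h2 h3
  refine hγ ?_
  have : γ = src (inv α.1) := comp_left_cancel hc (by simp) (by rw [← h4, comp_src])
  rw [this]
  exact src_mem _

/-- The regular representations are among the bounded ones and already separate the elements of
`C_c(G)`. -/
theorem toFull_injective : Function.Injective (toFull G) := by
  intro f g h
  refine regOp_injective (funext fun u => ?_)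
  exact congrArg (coordHom (regBdd u)) h

theorem norm_le_coordHom_orbitRep {a : FullCStar G} (ha : a ∈ c0UnitsFull G) :
    ‖a‖ ≤ ‖coordHom (orbitRep G) a‖ := by
  have hcl : IsClosed {a : FullCStar G |
      ‖a‖ ≤ ‖coordHom (orbitRep G) a‖} :=
    isClosed_le continuous_norm (continuous_coordHom (orbitRep G)).norm
  refine closure_minimal ?_ hcl ha
  rintro _ ⟨f, hf, rfl⟩
  change ‖toFull G f‖ ≤ ‖orbitOp f‖
  exact toFull_norm_le_orbitOp hf

theorem isTopologicallyPrincipal_of_everyNonzeroIdealMeets [LocallyCompactSpace G]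
    [SecondCountableTopology G] (h : EveryNonzeroIdealMeets (c0UnitsFull G)) :
    IsTopologicallyPrincipal G := by
  by_contra hG
  obtain ⟨B, hB, ⟨γ, hγ⟩, hiso, hinj, hunits⟩ := exists_isotropic_bisection hG
  obtain ⟨φ, hφ1, hφB, -⟩ := exists_bump hB hγ
  -- The orbit representation extends to `C*(G)` as one coordinate of the defining product.
  let I : Submodule ℂ (FullCStar G) := coordKer (fullHom G) (orbitRep G)
  refine h I (isClosedIdeal_coordKer _) (fun hI => ?_) ?_
  · have hmem : toFull G (φ.normSq - star φ * φ) ∈ I := by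
      rw [map_sub]
      refine mem_coordKer.2 ?_
      rw [map_sub, sub_eq_zero]
      exact orbitOp_normSq hiso hinj hφB
    rw [hI, Submodule.mem_bot, ← map_zero (toFull G)] at hmem
    have h1 := DFunLike.congr_fun (sub_eq_zero.1 (toFull_injective hmem)) γ
    rw [star_mul_self_apply_of_notMem_units hiso hinj hφB (hunits γ hγ), CcAlg.normSq_apply,
      hφ1] at h1
    simp at h1
  · refine (Submodule.eq_bot_iff _).2 fun a ha => ?_
    have := norm_le_coordHom_orbitRep ha.2
    rw [mem_coordKer.1 ha.1, norm_zero] at this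
    exact norm_le_zero_iff.1 this

end FullAlgebra

/-! ### Approximate division in closed ideals. -/

section ClosedIdeals

/-- Morally, `1 - z` is invertible and `p (1 - z) ∈ I`. Without a unit one shows inductively that `p
- p zⁿ ∈ I` and lets `p zⁿ → 0`. -/
theorem IsClosedIdeal.mem_of_sub_mul_mem {A : Type*} [NonUnitalCStarAlgebra A] {I : Submodule ℂ A}
    (hI : IsClosedIdeal I) {p z : A} (hz : ‖z‖ < 1) (h : p - p * z ∈ I) : p ∈ I := by
  -- This is `p zⁿ`, written as an iteration because `z⁰` has no meaning in a non-unital algebra.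
  let q : ℕ → A := fun n => (· * z)^[n] p
  have hq : ∀ n, q (n + 1) = q n * z := fun n => Function.iterate_succ_apply' _ _ _
  have hmem : ∀ n, p - q n ∈ I := fun n => by
    induction n with
    | zero => simp [q]
    | succ n ih =>
      have : p - q (n + 1) = (p - q n) * z + (p - p * z) := by rw [hq, sub_mul]; abel
      rw [this]
      exact I.add_mem (hI.mul_mem_right _ _ ih) h
  have hnorm : ∀ n, ‖q n‖ ≤ ‖z‖ ^ n * ‖p‖ := fun n => by
    induction n with
    | zero => simp [q]
    | succ n ih =>
      rw [hq, pow_succ']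
      calc ‖q n * z‖ ≤ ‖q n‖ * ‖z‖ := norm_mul_le _ _
        _ ≤ ‖z‖ ^ n * ‖p‖ * ‖z‖ := by gcongr
        _ = _ := by ring
  have hlim : Filter.Tendsto q Filter.atTop (𝓝 0) := by
    refine squeeze_zero_norm hnorm ?_
    simpa using (tendsto_pow_atTop_nhds_zero_of_lt_one (norm_nonneg z) hz).mul_const ‖p‖
  have := hlim.const_sub p
  rw [sub_zero] at this
  exact hI.isClosed.mem_of_tendsto this (Filter.Eventually.of_forall hmem)

end ClosedIdeals

/-! ### Functions on the unit space and ideals of the reduced algebra. -/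

section UnitFunctions

theorem inv_eq_of_mem_units {G : Type u} [ArrowGroupoid G] {u : G} (hu : u ∈ units G) : inv u = u := by
  have h := rng_comp_self (inv u)
  rwa [rng_inv, src_eq_of_mem hu, comp_inv, mem_units_iff.1 hu, eq_comm] at h

variable {G : Type u} [TopologicalSpace G] [ArrowGroupoid G] [IsEtaleGroupoid G] [T2Space G]

theorem ccUnits_mul_apply {h : CcAlg G} (hh : h ∈ ccUnits G) (f : CcAlg G) (γ : G) :
    (h * f) γ = h (rng γ) * f γ := by
  rw [CcAlg.mul_apply, tsum_eq_single ⟨rng γ, rng_rng γ⟩]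
  · simp only [inv_eq_of_mem_units (rng_mem γ), rng_comp_self]
  · rintro ⟨α, hα⟩ hne
    rw [hh α fun hu => hne (Subtype.ext ((mem_units_iff.1 hu).symm.trans hα)), zero_mul]

theorem mul_ccUnits_apply (f : CcAlg G) {h : CcAlg G} (hh : h ∈ ccUnits G) (γ : G) :
    (f * h) γ = f γ * h (src γ) := by
  rw [CcAlg.mul_apply, tsum_eq_single ⟨γ, rfl⟩]
  · simp only [inv_comp]
  · rintro ⟨α, hα⟩ hne
    rw [hh (inv α ⋄ γ) fun hu => hne (Subtype.ext ?_), mul_zero]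
    have hc : src (inv α) = rng γ := by simp [hα]
    have h1 : inv α ⋄ γ = src α := by
      rw [← mem_units_iff.1 hu, rng_comp _ _ hc, rng_inv]
    have h2 := comp_inv_cancel_left α γ hα
    rwa [h1, comp_src] at h2

/-- Each source or range fibre contains exactly one unit, so the `I`-norm of `f` is at most its
supremum norm. -/
theorem toReduced_norm_le_of_mem_ccUnits {f : CcAlg G} (hf : f ∈ ccUnits G) {C : ℝ} (hC : 0 ≤ C)
    (h : ∀ γ, ‖f γ‖ ≤ C) : ‖toReduced G f‖ ≤ C := by
  have hI : iNorm f ≤ ENNReal.ofReal C := (iNorm_le_of_mem_ccUnits hf).trans <|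
    iSup_le fun γ => by rw [← ofReal_norm]; exact ENNReal.ofReal_le_ofReal (h γ)
  rw [toReduced_norm]
  refine Real.iSup_le (fun v => (regRep_norm_le v f).trans ?_) hC
  exact ENNReal.toReal_le_of_le_ofReal hC hI

/-- A nonzero ideal of the reduced algebra contains an element with a nonzero diagonal coefficient. -/
theorem exists_diagonal_coeff_ne_zero {I : Submodule ℂ (ReducedCStar G)} (hI : IsClosedIdeal I)
    (hne : I ≠ ⊥) :
    ∃ c ∈ I, ∃ (u : units G) (γ : SrcFibre u), coordHom u c (delta γ) γ ≠ 0 := by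
  obtain ⟨a, ha, ha0⟩ := Submodule.exists_mem_ne_zero_of_ne_bot hne
  obtain ⟨u, hu⟩ : ∃ u, coordHom u a ≠ 0 := by
    by_contra! h
    exact ha0 (eq_zero_of_coordHom_eq_zero h)
  obtain ⟨γ, hγ⟩ : ∃ γ, coordHom u a (delta γ) ≠ 0 := by
    by_contra! h
    exact hu (ell2_op_ext fun i j => by rw [h]; rfl)
  -- The diagonal coefficient of `a* a` at `γ` is the squared norm of the image of `δ_γ` under `a`.
  refine ⟨star a * a, hI.mul_mem_left _ _ ha, u, γ, ?_⟩
  rw [map_mul, map_star, mul_apply_eq_comp, ← inner_delta_left,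
    ContinuousLinearMap.star_eq_adjoint, ContinuousLinearMap.adjoint_inner_right]
  exact inner_self_ne_zero.2 hγ

theorem coordHom_toReduced (u : units G) (γ : SrcFibre u) (f : CcAlg G) :
    coordHom u (toReduced G f) (delta γ) γ = f (rng γ.1) :=
  (regOp_delta u f γ γ).trans (by rw [comp_inv])

theorem toReduced_eq_zero {f : CcAlg G} (h : toReduced G f = 0) : f = 0 := by
  refine regOp_injective (funext fun u => ?_)
  change regOp u f = regOp u 0
  rw [regOp_zero]
  exact (congrArg (coordHom u) h).trans (map_zero _)

/-- A unit with trivial isotropy has a neighbourhood `V` such that off the unit space no element of a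
given compact set has both range and source in `V`. -/
theorem exists_open_compress {v : units G} (hv : {γ : G | rng γ = v ∧ src γ = v} = {(v : G)})
    {K : Set G} (hK : IsCompact K) :
    ∃ V : Set G, IsOpen V ∧ (v : G) ∈ V ∧ V ⊆ units G ∧
      ∀ γ ∈ K, rng γ ∈ V → src γ ∈ V → γ ∈ units G := by
  have hcont : Continuous fun γ : G => (rng γ, src γ) :=
    IsTopologicalGroupoid.continuous_rng.prodMk IsTopologicalGroupoid.continuous_src
  -- Removing the open unit space leaves `K` compact, so the set of pairs `(r γ, s γ)` is closed;
  -- trivial isotropy at `v` says that it misses `(v, v)`.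
  have hcl : IsClosed ((fun γ : G => (rng γ, src γ)) '' (K \ units G)) :=
    ((hK.diff isOpen_units).image hcont).isClosed
  have hmem : ((v : G), (v : G)) ∈ ((fun γ : G => (rng γ, src γ)) '' (K \ units G))ᶜ := by
    rintro ⟨γ, ⟨-, hγ⟩, h⟩
    rw [Prod.mk.injEq] at h
    have : γ ∈ ({(v : G)} : Set G) := hv ▸ h
    rw [Set.mem_singleton_iff.1 this] at hγ
    exact hγ v.2
  obtain ⟨V₁, V₂, h1, hv1, h2, hv2, hV⟩ :=
    mem_nhds_prod_iff'.1 (hcl.isOpen_compl.mem_nhds hmem)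
  refine ⟨V₁ ∩ V₂ ∩ units G, (h1.inter h2).inter isOpen_units, ⟨⟨hv1, hv2⟩, v.2⟩,
    Set.inter_subset_right, fun γ hγ hr hs => ?_⟩
  by_contra hγu
  exact hV (Set.mk_mem_prod hr.1.1 hs.1.2) ⟨γ, ⟨hγ, hγu⟩, rfl⟩

/-- If an ideal contains an element at distance `≤ ε` from `k ∈ C_c(G⁽⁰⁾)`, and `|k|` takes a value
larger than `2 ε`, then the ideal meets `C_c(G⁽⁰⁾)`. -/
theorem inf_ccUnitsReduced_ne_bot {I : Submodule ℂ (ReducedCStar G)} (hI : IsClosedIdeal I)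
    {ε : ℝ} (hε : 0 < ε) {k : CcAlg G} (hk : k ∈ ccUnits G) {x : ReducedCStar G} (hx : x ∈ I)
    (hkx : ‖toReduced G k - x‖ ≤ ε) {v : G} (hv : 2 * ε < ‖k v‖) :
    I ⊓ ccUnitsReduced G ≠ ⊥ := by
  have hpos : ∀ z : ℂ, 0 < max ‖z‖ (2 * ε) := fun z => lt_max_of_lt_right (by positivity)
  -- A truncated inverse: it equals `1/z` where `|z| ≥ 2ε` and is bounded by `1/(2ε)` everywhere.
  -- The cut-off `F₂` lives where `|z| > 2ε`, so there `F₁ z * z = 1`.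
  let F₁ : C(ℂ, ℂ) := ⟨fun z => star z / ((max ‖z‖ (2 * ε) : ℝ) : ℂ) ^ 2, by
    refine continuous_star.div (by fun_prop) fun z => ?_
    exact pow_ne_zero 2 (Complex.ofReal_ne_zero.2 (hpos z).ne')⟩
  let F₂ : C(ℂ, ℂ) := ⟨fun z => ((max (‖z‖ - 2 * ε) 0 : ℝ) : ℂ), by fun_prop⟩
  have hF₁ : F₁ 0 = 0 := by simp [F₁]
  have hF₂ : F₂ 0 = 0 := by simp [F₂, hε.le]
  have hF₁n : ∀ z, ‖F₁ z‖ ≤ (2 * ε)⁻¹ := fun z => by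
    change ‖star z / ((max ‖z‖ (2 * ε) : ℝ) : ℂ) ^ 2‖ ≤ _
    rw [norm_div, norm_pow, Complex.norm_real, Real.norm_of_nonneg (hpos z).le, norm_star]
    have h1 : ‖z‖ / max ‖z‖ (2 * ε) ^ 2 ≤ max ‖z‖ (2 * ε) / max ‖z‖ (2 * ε) ^ 2 := by
      gcongr; exact le_max_left _ _
    have h2 : max ‖z‖ (2 * ε) / max ‖z‖ (2 * ε) ^ 2 = (max ‖z‖ (2 * ε))⁻¹ := by
      have := (hpos z).ne'
      field_simp
    rw [h2] at h1
    exact h1.trans (inv_anti₀ (by positivity) (le_max_right _ _))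
  have hF : ∀ z, F₂ z * (F₁ z * z) = F₂ z := fun z => by
    rcases le_or_gt ‖z‖ (2 * ε) with h | h
    · have : F₂ z = 0 := by simp [F₂, h]
      rw [this, zero_mul]
    · have hz : F₁ z * z = 1 := by
        change star z / ((max ‖z‖ (2 * ε) : ℝ) : ℂ) ^ 2 * z = 1
        have hz0 : (‖z‖ : ℂ) ≠ 0 := Complex.ofReal_ne_zero.2 (by linarith)
        rw [max_eq_left h.le, div_mul_eq_mul_div, div_eq_one_iff_eq (pow_ne_zero 2 hz0)]
        exact Complex.conj_mul' z
      rw [hz, mul_one]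
  set m := k.map F₁ hF₁
  set p := k.map F₂ hF₂
  have hm : m ∈ ccUnits G := fun γ hγ => by rw [CcAlg.map_apply, hk γ hγ, hF₁]
  have hp : p ∈ ccUnits G := fun γ hγ => by rw [CcAlg.map_apply, hk γ hγ, hF₂]
  have hpmk : p * (m * k) = p := by
    ext γ
    rw [ccUnits_mul_apply hp, ccUnits_mul_apply hm]
    by_cases hγ : γ ∈ units G
    · rw [mem_units_iff.1 hγ]; exact hF _
    · rw [hk γ hγ, hp γ hγ, mul_zero, mul_zero]
  have hpI : toReduced G p ∈ I := by
    -- The norm of `m (k - x)` is at most `ε / (2ε) = 1/2`, and `p m k = p` gives `p - p m (k - x) =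
    -- p m x ∈ I`.
    refine hI.mem_of_sub_mul_mem (z := toReduced G m * (toReduced G k - x)) ?_ ?_
    · calc _ ≤ ‖toReduced G m‖ * ‖toReduced G k - x‖ := norm_mul_le _ _
        _ ≤ (2 * ε)⁻¹ * ε := by
          gcongr
          exact toReduced_norm_le_of_mem_ccUnits hm (by positivity) fun γ => hF₁n _
        _ < 1 := by field_simp; norm_num
    · rw [mul_sub, mul_sub, ← map_mul, ← map_mul, hpmk, sub_sub_cancel]
      exact hI.mul_mem_left _ _ (hI.mul_mem_left _ _ hx)
  intro hbot
  have h0 : toReduced G p ∈ I ⊓ ccUnitsReduced G := ⟨hpI, p, hp, rfl⟩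
  rw [hbot, Submodule.mem_bot] at h0
  have h1 : F₂ (k v) = 0 := DFunLike.congr_fun (toReduced_eq_zero h0) v
  have h2 : max (‖k v‖ - 2 * ε) 0 = 0 := Complex.ofReal_eq_zero.1 h1
  have := le_max_left (‖k v‖ - 2 * ε) 0
  linarith

theorem everyNonzeroIdealMeets_of_isTopologicallyPrincipal [LocallyCompactSpace G]
    (hG : IsTopologicallyPrincipal G) : EveryNonzeroIdealMeets (ccUnitsReduced G) := by
  intro I hI hne
  obtain ⟨c, hc, u, γ, hγ⟩ := exists_diagonal_coeff_ne_zero hI hne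
  set M := ‖coordHom u c (delta γ) γ‖ with hM
  have hMpos : 0 < M := norm_pos_iff.2 hγ
  -- With `ε = M/4`, the value of `b` at `r γ` exceeds `3M/4` in modulus, above the threshold `2ε =
  -- M/2`.
  obtain ⟨b, hb⟩ := (toReduced_denseRange (G := G)).exists_dist_lt c (ε := M / 4) (by positivity)
  rw [dist_comm, dist_eq_norm] at hb
  have hbu : 2 * (M / 4) < ‖b (rng γ.1)‖ := by
    have h1 : ‖coordHom u (toReduced G b - c) (delta γ) γ‖ < M / 4 :=
      ((norm_delta_coeff_le _ _ _).trans (norm_coordHom_le u _)).trans_lt hb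
    rw [map_sub, sub_apply, lp.coeFn_sub, Pi.sub_apply, coordHom_toReduced] at h1
    have h2 := norm_sub_norm_le (coordHom u c (delta γ) γ) (b (rng γ.1))
    rw [norm_sub_rev, ← hM] at h2
    linarith
  -- The only use of topological principality: the unit `r γ` is traded for one with trivial
  -- isotropy where `b` is still large.
  obtain ⟨v, hvb, hv⟩ := hG.inter_open_nonempty {v : units G | 2 * (M / 4) < ‖b v‖}
    (isOpen_lt continuous_const (b.continuous.comp continuous_subtype_val).norm)
    ⟨rngU γ.1, hbu⟩
  obtain ⟨V, hV, hvV, hVu, hVb⟩ := exists_open_compress hv b.isCompact_tsupport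
  obtain ⟨h, hh1, hhV, hhn⟩ := exists_bump hV hvV
  have hh : h ∈ ccUnits G := fun γ hγ => hhV γ fun h' => hγ (hVu h')
  have hk : ∀ γ, (h * b * h) γ = h (rng γ) * b γ * h (src γ) := fun γ => by
    rw [mul_ccUnits_apply _ hh, ccUnits_mul_apply hh]
  refine inf_ccUnitsReduced_ne_bot hI (k := h * b * h)
    (x := toReduced G h * c * toReduced G h) (v := v) (ε := M / 4) (by positivity) ?_
    (hI.mul_mem_right _ _ (hI.mul_mem_left _ _ hc)) ?_ ?_
  · intro γ hγ
    rw [hk]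
    by_contra hne
    refine hγ (hVb γ (subset_tsupport _ (right_ne_zero_of_mul (left_ne_zero_of_mul hne))) ?_ ?_)
    · by_contra hr
      exact left_ne_zero_of_mul (left_ne_zero_of_mul hne) (hhV _ hr)
    · by_contra hs
      exact right_ne_zero_of_mul hne (hhV _ hs)
  -- Compression by `h` does not increase the distance `M/4`, and `h v = 1` preserves the value at
  -- `v`.
  · have hh' : ‖toReduced G h‖ ≤ 1 := toReduced_norm_le_of_mem_ccUnits hh zero_le_one hhn
    rw [map_mul, map_mul, ← sub_mul, ← mul_sub]
    calc _ ≤ ‖toReduced G h‖ * ‖toReduced G b - c‖ * ‖toReduced G h‖ :=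
          (norm_mul_le _ _).trans (by gcongr; exact norm_mul_le _ _)
      _ ≤ 1 * (M / 4) * 1 := by gcongr
      _ = M / 4 := by ring
  · rw [hk, mem_units_iff.1 v.2, src_eq_of_mem v.2, hh1, one_mul, mul_one]
    exact hvb

end UnitFunctions

end ArrowGroupoid

theorem proposition5p5 {G : Type*} [TopologicalSpace G] [ArrowGroupoid G]
    [ArrowGroupoid.IsEtaleGroupoid G] [T2Space G] [LocallyCompactSpace G]
    [SecondCountableTopology G] :
    (ArrowGroupoid.IsTopologicallyPrincipal G →
      ArrowGroupoid.EveryNonzeroIdealMeets (ArrowGroupoid.ccUnitsReduced G)) ∧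
    (ArrowGroupoid.EveryNonzeroIdealMeets (ArrowGroupoid.c0UnitsFull G) →
      ArrowGroupoid.IsTopologicallyPrincipal G) := by
  exact ⟨ArrowGroupoid.everyNonzeroIdealMeets_of_isTopologicallyPrincipal,
    ArrowGroupoid.isTopologicallyPrincipal_of_everyNonzeroIdealMeets⟩
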